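/- Let $k$ be a non-archimedean local field with ring of integers $\mathfrak o$, residue field of cardinality $q$, and normalized absolute value $|\cdot|$ (so uniformizers have absolute value $q^{-1}$), and assume that $2\in\mathfrak o^\times$. Let $n\ge 1$ be odd. Equip $k^{n+3}=(k\,e_+)\oplus k^{n+1}\oplus(k\,e_-)$ (row vectors) with the symmetric bilinear form for which this decomposition is orthogonal, $\langle e_+,e_+\rangle=1$, $\langle e_-,e_-\rangle=-1$, and whose Gram matrix on $k^{n+1}$ is a symmetric matrix $A\in M_{n+1}(\mathfrak o)$ with $\det A\in\mathfrak o^\times$. Let $G=\mathrm O(n+3)$ be its orthogonal group, acting on the right; let $H=\mathrm O(n+2)$ be the subgroup of $G$ fixing $e_-$ (the orthogonal group of $k^{n+2}=(k\,e_+)\oplus k^{n+1}$), and let $\varTheta=\mathrm O(n+1)$ be the subgroup fixing both $e_+$ and $e_-$. Let $\varDelta=(-1)^{(n+1)/2}\det A$ be the discriminant of the form on $k^{n+2}$, and let $\chi$ be the non-trivial character of $\mathfrak o^\times/(\mathfrak o^\times)^2$. Write $$Z(\alpha)=\frac1{1-q^{-\alpha}},\qquad L(\alpha,\chi)=\frac1{1-\chi(\varDelta)\,q^{-\alpha}}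 .$$ Put $e=e_++e_-$, let $\Phi$ be the characteristic function of $\mathfrak o^{n+3}$, and for $s\in\mathbb C$ and $\alpha=(n+1)s$ set $$\varphi(g)=\int_{k^\times}|t|^{\alpha}\,\Phi(t e\cdot g)\,d^\times t,\qquad \varphi^\circ(g)=\frac{\varphi(g)}{\varphi(1)}\qquad(g\in G),$$ where $d^\times t$ is the Haar measure on $k^\times$ with $\operatorname{vol}(\mathfrak o^\times)=1$; the function $\varphi^\circ$ is left $\varTheta$-invariant. Then for every non-zero right $H$-invariant Borel measure on $\varTheta\backslash H$ which is finite on compact sets there is a constant $C>0$, independent of $s$, such that, for all $s\in\mathbb C$ with $\operatorname{Re}\bigl((n+1)(s-1)+1\bigr)>0$, the function $\varphi^\circ$ is integrable on $\varTheta\backslash H$ and $$\int_{\varTheta\backslash H}\varphi^\circ \;=\; C\cdot\frac{Z\bigl((n+1)(s-1)+1\bigr)}{L\bigl((n+1)(s-\tfrac12)+1,\chi\bigr)} .$$ This includes the case $n=1$. -/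

import Mathlib

open scoped NormedField
open MeasureTheory Matrix

namespace OrthogonalPeriod

section LocalFactors

variable (k : Type*) [NontriviallyNormedField k] [IsUltrametricDist k]

/-- The ring of integers `{x | ‖x‖ ≤ 1}` of `k`. -/
noncomputable abbrev IntRing : Subring k := Valued.integer k

/-- The cardinality `q` of the residue field. -/
noncomputable def resCard : ℕ := Nat.card (IsLocalRing.ResidueField (IntRing k))

/-- The norm of `k` is the normalized absolute value: uniformizers have norm `1 / q`. -/
def IsNormalized : Prop :=
  ∀ ϖ : IntRing k, Irreducible ϖ → ‖(ϖ : k)‖ = (resCard k : ℝ)⁻¹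

/-- The local zeta factor `Z(α) = 1 / (1 - q ^ (-α))`. -/
noncomputable def Zfactor (α : ℂ) : ℂ := 1 / (1 - (resCard k : ℂ) ^ (-α))

variable {k}

open Classical in
/-- The value on the unit `u` of the quadratic character `χ` of the units modulo squares
(nontrivial of order two when the residue characteristic is odd). -/
noncomputable def quadChar (u : IntRing k) : ℂ := if IsSquare u then 1 else -1

/-- The local factor `L(α, χ) = 1 / (1 - ε q ^ (-α))` with `ε = χ(Δ)`. -/
noncomputable def Lfactor (Δ : IntRing k) (α : ℂ) : ℂ :=
  1 / (1 - quadChar Δ * (resCard k : ℂ) ^ (-α))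

end LocalFactors

/-- Coordinates of `k^(n+3) = k e₊ ⊕ k^(n+1) ⊕ k e₋`, in this order. -/
abbrev Idx (n : ℕ) : Type := Unit ⊕ (Fin (n + 1) ⊕ Unit)

section Groups

variable {k : Type*} [NontriviallyNormedField k] [IsUltrametricDist k] {n : ℕ}

/-- The vector `e₊`. -/
def ePlus (k : Type*) [Field k] (n : ℕ) : Idx n → k := Pi.single (Sum.inl ()) 1

/-- The vector `e₋`. -/
def eMinus (k : Type*) [Field k] (n : ℕ) : Idx n → k := Pi.single (Sum.inr (Sum.inr ())) 1

/-- The isotropic vector `e = e₊ + e₋`. -/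
def eIso (k : Type*) [Field k] (n : ℕ) : Idx n → k := ePlus k n + eMinus k n

/-- The Gram matrix `diag(1, A, -1)` of the form on `k^(n+3)`, where `A` is the Gram matrix of
its restriction to `k^(n+1)`. -/
noncomputable def gram (A : Matrix (Fin (n + 1)) (Fin (n + 1)) (IntRing k)) : Matrix (Idx n) (Idx n) k :=
  Matrix.fromBlocks 1 0 0 (Matrix.fromBlocks (A.map (fun x => (x : k))) 0 0 (-1))

/-- The discriminant of the form on `k^(n+2) = k e₊ ⊕ k^(n+1)` for odd `n`, with the sign for which
a hyperbolic plane has discriminant `1` (so that adding hyperbolic planes does not change it). -/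
noncomputable def disc (A : Matrix (Fin (n + 1)) (Fin (n + 1)) (IntRing k)) : IntRing k :=
  (-1) ^ ((n + 1) / 2) * A.det

/-- The matrices which, acting on row vectors from the right, preserve the bilinear form with
Gram matrix `S`. -/
def orthGroup {ι K : Type*} [Fintype ι] [DecidableEq ι] [Field K] (S : Matrix ι ι K) :
    Subgroup (GL ι K) where
  carrier := {g | (g : Matrix ι ι K) * S * (g : Matrix ι ι K)ᵀ = S}
  one_mem' := by simp
  mul_mem' := by
    intro a b ha hb
    simp only [Set.mem_ofPred_eq] at ha hb ⊢
    calc ((a * b : GL ι K) : Matrix ι ι K) * S * ((a * b : GL ι K) : Matrix ι ι K)ᵀ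
        = (a : Matrix ι ι K) * ((b : Matrix ι ι K) * S * (b : Matrix ι ι K)ᵀ)
            * (a : Matrix ι ι K)ᵀ := by
          simp only [Units.val_mul, Matrix.transpose_mul, Matrix.mul_assoc]
      _ = S := by rw [hb, ha]
  inv_mem' := by
    intro a ha
    simp only [Set.mem_ofPred_eq] at ha ⊢
    have h1 : ((a⁻¹ : GL ι K) : Matrix ι ι K) * (a : Matrix ι ι K) = 1 := by
      rw [← Units.val_mul]; simp
    have h2 : (a : Matrix ι ι K)ᵀ * ((a⁻¹ : GL ι K) : Matrix ι ι K)ᵀ = 1 := by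
      rw [← Matrix.transpose_mul, h1, Matrix.transpose_one]
    calc ((a⁻¹ : GL ι K) : Matrix ι ι K) * S * ((a⁻¹ : GL ι K) : Matrix ι ι K)ᵀ
        = ((a⁻¹ : GL ι K) : Matrix ι ι K) * ((a : Matrix ι ι K) * S * (a : Matrix ι ι K)ᵀ)
            * ((a⁻¹ : GL ι K) : Matrix ι ι K)ᵀ := by rw [ha]
      _ = (((a⁻¹ : GL ι K) : Matrix ι ι K) * (a : Matrix ι ι K)) * S
            * ((a : Matrix ι ι K)ᵀ * ((a⁻¹ : GL ι K) : Matrix ι ι K)ᵀ) := by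
          simp only [Matrix.mul_assoc]
      _ = S := by rw [h1, h2]; simp

/-- The fixer of the row vector `v`. -/
def fixer {ι K : Type*} [Fintype ι] [DecidableEq ι] [Field K] (v : ι → K) :
    Subgroup (GL ι K) where
  carrier := {g | v ᵥ* (g : Matrix ι ι K) = v}
  one_mem' := by simp
  mul_mem' := by
    intro a b ha hb
    simp only [Set.mem_ofPred_eq] at ha hb ⊢
    rw [Units.val_mul, ← Matrix.vecMul_vecMul, ha, hb]
  inv_mem' := by
    intro a ha
    simp only [Set.mem_ofPred_eq] at ha ⊢
    have h1 : (a : Matrix ι ι K) * ((a⁻¹ : GL ι K) : Matrix ι ι K) = 1 := by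
      rw [← Units.val_mul]; simp
    conv_lhs => rw [← ha]
    rw [Matrix.vecMul_vecMul, h1, Matrix.vecMul_one]

/-- The orthogonal group `G = O(n+3)` of the form on `k^(n+3)`. -/
noncomputable def G (A : Matrix (Fin (n + 1)) (Fin (n + 1)) (IntRing k)) : Subgroup (GL (Idx n) k) :=
  orthGroup (gram A)

/-- `H = O(n+2)`, the orthogonal group of `k^(n+2) = e₋^⊥`, as the fixer of `e₋` in `G`. -/
noncomputable def H (A : Matrix (Fin (n + 1)) (Fin (n + 1)) (IntRing k)) : Subgroup (GL (Idx n) k) :=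
  G A ⊓ fixer (eMinus k n)

/-- `Θ = O(n+1)`, the fixer of `e₊` and `e₋`, as a subgroup of `H`. -/
noncomputable def Theta (A : Matrix (Fin (n + 1)) (Fin (n + 1)) (IntRing k)) : Subgroup (H A) :=
  (fixer (ePlus k n)).subgroupOf (H A)

/-- The space `Θ \ H` of cosets `Θ h`. -/
def ThetaH (A : Matrix (Fin (n + 1)) (Fin (n + 1)) (IntRing k)) : Type _ :=
  Quotient (QuotientGroup.rightRel (Theta A))

/-- The quotient topology on `Θ \ H`. -/
instance (A : Matrix (Fin (n + 1)) (Fin (n + 1)) (IntRing k)) : TopologicalSpace (ThetaH A) :=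
  inferInstanceAs (TopologicalSpace (Quotient (QuotientGroup.rightRel (Theta A))))

instance (A : Matrix (Fin (n + 1)) (Fin (n + 1)) (IntRing k)) : MeasurableSpace (ThetaH A) :=
  borel (ThetaH A)

instance (A : Matrix (Fin (n + 1)) (Fin (n + 1)) (IntRing k)) : BorelSpace (ThetaH A) := ⟨rfl⟩

/-- Right translation `Θ x ↦ Θ x h` on `Θ \ H`. -/
noncomputable def translate (A : Matrix (Fin (n + 1)) (Fin (n + 1)) (IntRing k)) (h : H A) :
    ThetaH A → ThetaH A :=
  Quotient.map (fun x => x * h) (by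
    intro a b hab
    rw [← Quotient.eq_iff_equiv, Quotient.eq, QuotientGroup.rightRel_apply] at hab ⊢
    simpa [mul_assoc] using hab)

/-- Invariance of a measure on `Θ \ H` under the right action of `H`. -/
def IsInvariant (A : Matrix (Fin (n + 1)) (Fin (n + 1)) (IntRing k)) (μ : Measure (ThetaH A)) : Prop :=
  ∀ h : H A, MeasurePreserving (translate A h) μ μ

/-- The characteristic function `Φ` of `𝒪^(n+3)`. -/
noncomputable def Phi (k : Type*) [NontriviallyNormedField k] (n : ℕ) : (Idx n → k) → ℂ :=
  Set.indicator {v | ∀ i, ‖v i‖ ≤ 1} 1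

/-- `φ(g) = ∫ |t|^α Φ(t e · g) d^×t`, where `ν` is the measure `d^×t` on `kˣ`. -/
noncomputable def phi [MeasurableSpace kˣ] (ν : Measure kˣ) (α : ℂ) (g : GL (Idx n) k) : ℂ :=
  ∫ t : kˣ, ((‖(t : k)‖ : ℝ) : ℂ) ^ α
    * Phi k n ((t : k) • (eIso k n ᵥ* (g : Matrix (Idx n) (Idx n) k))) ∂ν

/-- The normalized spherical function `φ° = φ / φ(1)`. -/
noncomputable def phiNorm [MeasurableSpace kˣ] (ν : Measure kˣ) (α : ℂ) (g : GL (Idx n) k) : ℂ :=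
  phi ν α g / phi ν α (1 : GL (Idx n) k)

lemma phiNorm_theta_mul [MeasurableSpace kˣ] (ν : Measure kˣ) (α : ℂ)
    (A : Matrix (Fin (n + 1)) (Fin (n + 1)) (IntRing k)) (x y : H A) (hxy : y * x⁻¹ ∈ Theta A) :
    phiNorm ν α (x : GL (Idx n) k) = phiNorm ν α (y : GL (Idx n) k) := by
  have key : ∀ v : Idx n → k, v ᵥ* ((y * x⁻¹ : H A) : GL (Idx n) k).val = v →
      v ᵥ* (y : GL (Idx n) k).val = v ᵥ* (x : GL (Idx n) k).val := by
    intro v hv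
    have h0 : (y : GL (Idx n) k) = ((y * x⁻¹ : H A) : GL (Idx n) k) * (x : GL (Idx n) k) := by
      simp
    conv_lhs => rw [h0, Units.val_mul, ← Matrix.vecMul_vecMul, hv]
  have hp := key (ePlus k n) hxy
  have hm := key (eMinus k n) (y * x⁻¹).2.2
  have he : eIso k n ᵥ* (y : GL (Idx n) k).val = eIso k n ᵥ* (x : GL (Idx n) k).val := by
    rw [eIso, Matrix.add_vecMul, Matrix.add_vecMul, hp, hm]
  simp only [phiNorm, phi, he]

/-- `φ°` as a function on `Θ \ H`. -/
noncomputable def phiQuot [MeasurableSpace kˣ] (ν : Measure kˣ) (α : ℂ)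
    (A : Matrix (Fin (n + 1)) (Fin (n + 1)) (IntRing k)) : ThetaH A → ℂ :=
  Quotient.lift (fun h : H A => phiNorm ν α (h : GL (Idx n) k)) (by
    intro a b hab
    rw [← Quotient.eq_iff_equiv, Quotient.eq, QuotientGroup.rightRel_apply] at hab
    exact phiNorm_theta_mul ν α A a b hab)

end Groups

end OrthogonalPeriod

/-! Let Q be the form on k^(n+2). The map Θh ↦ e₊h identifies Θ\H with the quadric Q = 1
(`orbitMap_injective`, `exists_basePoint_vecMul_eq`). Since eh = e₊h + e₋, a change of variable in
the Tate integral gives φ°(h) = max(1, ‖e₊h‖)^(-α) for the sup norm (`phiQuot_eq`). Hence only the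
distribution of the norm on the quadric matters.

The invariant measure is realised through Haar measure on k^(n+2). On the open cone |Q(v) - 1| < 1
the value Q(v) has a square root among the principal units, and v ↦ v/√Q(v) pushes Haar measure to
an H-invariant measure on the quadric (`coneMeasure`). Sigma-finite invariant measures carried by
one orbit are proportional (`exists_eq_smul_of_invariant`), so the given measure is a multiple of
this one (`exists_map_orbitMap_eq_smul`). Radial projection divides by a unit and preserves norms,
so the period is a constant times the integral of ‖v‖^(-α) over the cone, where ‖v‖ ≥ 1.

Write n + 2 = 2r + 1, ε = χ(Δ), and let b be the volume of the open unit ball. The part of the cone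
with ‖v‖ = q^j has volume b(q^(2r) + εq^r) for j = 0 and b(q^(2r) - 1)q^(j(2r-1)) for j ≥ 1
(`measureReal_levelSet`). These come from counting the solutions of Q = 1 and the nonzero solutions
of Q = 0 over the residue field (`card_quadratic_eq`) together with a Hensel argument
(`pow_mul_measure_residueBall_inter`). With y = q^(2r-1-α) the geometric series sums to b(q^(2r) +
εq^r)(1 - εq^(-r)y)/(1 - y), and the last quotient is Z/L (`integral_principalCone`). -/

namespace OrthogonalPeriod

/-! ### Uniqueness of invariant measures on an orbit. -/

section InvariantMeasures

open Function

variable {W : Type*} [MeasurableSpace W]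

/-- With f the density of μ, the integral of f ∘ e over e⁻¹(t) is that of f over t, namely μ(t) =
μ(e⁻¹(t)). So f ∘ e is also a density of μ, and densities are almost everywhere unique. -/
lemma rnDeriv_comp_ae_eq {μ τ : Measure W} [SigmaFinite μ] [SigmaFinite τ] (hac : μ ≪ τ)
    (e : W ≃ᵐ W) (hμ : MeasurePreserving e μ μ) (hτ : MeasurePreserving e τ τ) :
    (fun x => μ.rnDeriv τ (e x)) =ᵐ[τ] μ.rnDeriv τ := by
  have hm : Measurable (fun x => μ.rnDeriv τ (e x)) :=
    (Measure.measurable_rnDeriv μ τ).comp e.measurable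
  have key : τ.withDensity (fun x => μ.rnDeriv τ (e x)) = μ := by
    ext s hs
    have hs' : s = e ⁻¹' (e.symm ⁻¹' s) := by
      ext x; simp
    have ht : MeasurableSet (e.symm ⁻¹' s) := e.symm.measurable hs
    rw [withDensity_apply _ hs]
    conv_lhs => rw [hs']
    rw [hτ.setLIntegral_comp_preimage ht (Measure.measurable_rnDeriv μ τ),
      Measure.setLIntegral_rnDeriv hac]
    conv_rhs => rw [hs']
    exact (hμ.measure_preimage ht.nullMeasurableSet).symm
  have := Measure.rnDeriv_withDensity τ hm
  rw [key] at this
  exact this.symm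

variable {Γ : Type*} [Group Γ] [MeasurableSpace Γ] [MeasurableMul Γ]

/-- An invariant measure concentrated on one orbit and absolutely continuous with respect to an
invariant measure concentrated on the same orbit is a multiple of it. -/
lemma exists_eq_smul_of_absolutelyContinuous (lam : Measure Γ) [SigmaFinite lam]
    [lam.IsMulLeftInvariant] (hlam : lam ≠ 0) (a : W → Γ → W) (ha : Measurable (uncurry a))
    (ha1 : ∀ x, a x 1 = x) (hmul : ∀ x g h, a (a x g) h = a x (g * h))
    {μ τ : Measure W} [SigmaFinite μ] [SigmaFinite τ] (hac : μ ≪ τ)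
    (hμ : ∀ g, MeasurePreserving (fun x => a x g) μ μ)
    (hτ : ∀ g, MeasurePreserving (fun x => a x g) τ τ)
    (x₀ : W) (horb : ∀ᵐ x ∂τ, ∃ g, a x₀ g = x) :
    ∃ c : ENNReal, c ≠ ⊤ ∧ μ = c • τ := by
  by_cases hτ0 : τ = 0
  · refine ⟨0, ENNReal.zero_ne_top, ?_⟩
    subst hτ0
    simpa using hac
  set f := μ.rnDeriv τ with hf
  have hfm : Measurable f := Measure.measurable_rnDeriv μ τ
  have hinv : ∀ g, ∀ᵐ x ∂τ, f (a x g) = f x := by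
    intro g
    have hm : ∀ g, Measurable (fun x => a x g) := fun g => ha.comp measurable_prodMk_right
    let e : W ≃ᵐ W :=
      { toFun := fun x => a x g
        invFun := fun x => a x g⁻¹
        left_inv := fun x => by simp [hmul, ha1]
        right_inv := fun x => by simp [hmul, ha1]
        measurable_toFun := hm g
        measurable_invFun := hm g⁻¹ }
    exact rnDeriv_comp_ae_eq hac e (hμ g) (hτ g)
  have hset : MeasurableSet {p : W × Γ | f (a p.1 p.2) = f p.1} :=
    measurableSet_eq_fun (hfm.comp ha) (hfm.comp measurable_fst)
  -- In `hinv` the exceptional set depends on g. Fubini exchanges the quantifiers, so f is almost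
  -- constant along the orbit of almost every x.
  have hswap : ∀ᵐ x ∂τ, ∀ᵐ g ∂lam, f (a x g) = f x := by
    rw [Measure.ae_ae_comm hset]
    exact Filter.Eventually.of_forall hinv
  have : NeZero τ := ⟨hτ0⟩
  -- One good point on the orbit, with finite density there; f x₁ will be the constant.
  obtain ⟨x₁, hx₁, ⟨g₁, hg₁⟩, htop⟩ :=
    (hswap.and (horb.and (Measure.rnDeriv_lt_top μ τ))).exists
  -- Left invariance of `lam` transports the statement from the base point x₁ to every point of the
  -- orbit.
  have hx : ∀ g, ∀ᵐ h ∂lam, f (a (a x₀ g) h) = f x₁ := by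
    intro g
    have h1 : ∀ᵐ h ∂lam, f (a x₁ ((g₁⁻¹ * g) * h)) = f x₁ := by
      have := (measurePreserving_mul_left lam (g₁⁻¹ * g)).quasiMeasurePreserving.ae hx₁
      exact this
    filter_upwards [h1] with h hh
    rw [← hh, ← hg₁, hmul, hmul]
    congr 2
    group
  have hset' : MeasurableSet {p : W × Γ | f (a p.1 p.2) = f x₁} :=
    measurableSet_eq_fun (hfm.comp ha) measurable_const
  -- Exchanging back yields a single h with f(xh) = f(x₁) for almost all x; invariance of f under
  -- this h then makes f almost everywhere constant.
  have hall : ∀ᵐ h ∂lam, ∀ᵐ x ∂τ, f (a x h) = f x₁ := by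
    rw [← Measure.ae_ae_comm hset']
    filter_upwards [horb] with x hxo
    obtain ⟨g, rfl⟩ := hxo
    exact hx g
  have : NeZero lam := ⟨hlam⟩
  obtain ⟨h, hh⟩ := hall.exists
  have hconst : f =ᵐ[τ] fun _ => f x₁ := by
    filter_upwards [hh, hinv h] with x h1 h2
    rw [← h2, h1]
  refine ⟨f x₁, htop.ne, ?_⟩
  rw [← Measure.withDensity_rnDeriv_eq μ τ hac, ← hf, withDensity_congr_ae hconst,
    withDensity_const]

/-- Uniqueness of invariant measures concentrated on one orbit. -/
theorem exists_eq_smul_of_invariant (lam : Measure Γ) [SigmaFinite lam]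
    [lam.IsMulLeftInvariant] (hlam : lam ≠ 0) (a : W → Γ → W) (ha : Measurable (uncurry a))
    (ha1 : ∀ x, a x 1 = x) (hmul : ∀ x g h, a (a x g) h = a x (g * h))
    {μ σ : Measure W} [SigmaFinite μ] [SigmaFinite σ] (hσ0 : σ ≠ 0)
    (hμ : ∀ g, MeasurePreserving (fun x => a x g) μ μ)
    (hσ : ∀ g, MeasurePreserving (fun x => a x g) σ σ)
    (x₀ : W) (horbμ : ∀ᵐ x ∂μ, ∃ g, a x₀ g = x) (horbσ : ∀ᵐ x ∂σ, ∃ g, a x₀ g = x) :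
    ∃ c : ENNReal, c ≠ ⊤ ∧ μ = c • σ := by
  -- Neither measure is known to dominate the other, but both are absolutely continuous with respect
  -- to their sum, which is again invariant.
  have hsum : ∀ g, MeasurePreserving (fun x => a x g) (μ + σ) (μ + σ) := fun g =>
    ⟨(hμ g).measurable, by rw [Measure.map_add _ _ (hμ g).measurable, (hμ g).map_eq, (hσ g).map_eq]⟩
  have horb : ∀ᵐ x ∂(μ + σ), ∃ g, a x₀ g = x := by
    rw [ae_add_measure_iff]; exact ⟨horbμ, horbσ⟩
  obtain ⟨c, hc, hμc⟩ := exists_eq_smul_of_absolutelyContinuous lam hlam a ha ha1 hmul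
    (Measure.AbsolutelyContinuous.rfl.add_right σ : μ ≪ μ + σ) hμ hsum x₀ horb
  obtain ⟨d, hd, hσd⟩ := exists_eq_smul_of_absolutelyContinuous lam hlam a ha ha1 hmul
    (by rw [add_comm]; exact Measure.AbsolutelyContinuous.rfl.add_right μ : σ ≪ μ + σ)
    hσ hsum x₀ horb
  have hd0 : d ≠ 0 := by
    rintro rfl
    exact hσ0 (by rw [hσd, zero_smul])
  refine ⟨c * d⁻¹, ENNReal.mul_ne_top hc (ENNReal.inv_ne_top.2 hd0), ?_⟩
  conv_rhs => rw [hσd]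
  rw [smul_smul, mul_assoc, ENNReal.inv_mul_cancel hd0 hd, mul_one]
  exact hμc

end InvariantMeasures

/-! ### Point counts on quadrics over finite fields. -/

section FiniteFieldCount

variable {F : Type*} [Field F] {ι : Type*} [Fintype ι] [DecidableEq ι]

/-- The rows of P are an orthogonal basis for S. -/
lemma exists_mul_mul_transpose_eq_diagonal (h2 : (2 : F) ≠ 0) (S : Matrix ι ι F) (hS : S.IsSymm) :
    ∃ (P : Matrix ι ι F) (d : ι → F), IsUnit P ∧ P * S * Pᵀ = diagonal d := by
  have : Invertible (2 : F) := invertibleOfNonzero h2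
  obtain ⟨v, hv⟩ := LinearMap.BilinForm.exists_orthogonal_basis
    (B := Matrix.toBilin' S) (by
      constructor
      intro x y
      simp only [Matrix.toBilin'_apply', RingHom.id_apply]
      rw [dotProduct_mulVec, dotProduct_comm, ← mulVec_transpose, hS.eq])
  have hcard : Module.finrank F (ι → F) = Fintype.card ι := by simp
  let e : Fin (Module.finrank F (ι → F)) ≃ ι :=
    Fintype.equivOfCardEq (by simp)
  let w : Module.Basis ι F (ι → F) := v.reindex e
  let P : Matrix ι ι F := fun i j => w i j
  have hP : P = ((Pi.basisFun F ι).toMatrix w)ᵀ := by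
    ext i j
    simp [P, Module.Basis.toMatrix_apply]
  refine ⟨P, fun i => (P * S * Pᵀ) i i, ?_, ?_⟩
  · rw [hP, Matrix.isUnit_transpose]
    have := (Pi.basisFun F ι).invertibleToMatrix w
    exact isUnit_of_invertible _
  · ext i j
    by_cases hij : i = j
    · subst hij; simp
    · rw [diagonal_apply_ne _ hij]
      have h1 : v (e.symm i) ⬝ᵥ S *ᵥ v (e.symm j) = 0 := by
        have := hv (i := e.symm i) (j := e.symm j) (by simpa using hij)
        simpa [LinearMap.IsOrthoᵢ, Function.onFun, Matrix.toBilin'_apply'] using this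
      rw [← h1, dotProduct_mulVec]
      simp only [Matrix.mul_apply, transpose_apply, dotProduct, vecMul]
      simp [P, w]

lemma addChar_sum (ψ : AddChar F ℂ) (f : ι → F) : ψ (∑ i, f i) = ∏ i, ψ (f i) := by
  induction (Finset.univ : Finset ι) using Finset.induction_on with
  | empty => simp
  | insert i s hi ih => rw [Finset.sum_insert hi, Finset.prod_insert hi, AddChar.map_add_eq_mul, ih]

variable [Fintype F] [DecidableEq F]

/-- The quadratic character with complex values. -/
noncomputable def quadraticCharComplex (F : Type*) [Field F] [Fintype F] [DecidableEq F] :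
    MulChar F ℂ :=
  (quadraticChar F).ringHomComp (Int.castRingHom ℂ)

lemma quadraticCharComplex_apply (a : F) :
    quadraticCharComplex F a = (quadraticChar F a : ℂ) := rfl

lemma quadraticCharComplex_ne_one (hF : ringChar F ≠ 2) : quadraticCharComplex F ≠ 1 :=
  (MulChar.ringHomComp_ne_one_iff Int.cast_injective).2 (quadraticChar_ne_one hF)

lemma quadraticCharComplex_isQuadratic : (quadraticCharComplex F).IsQuadratic :=
  (quadraticChar_isQuadratic F).comp _

/-- Allowing b = 0, where both sides vanish, lets the point count treat all values c uniformly. -/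
lemma sum_quadraticCharComplex_mul (hF : ringChar F ≠ 2) (ψ : AddChar F ℂ)
    (b : F) : ∑ t, quadraticCharComplex F t * ψ (b * t) =
      quadraticCharComplex F b * gaussSum (quadraticCharComplex F) ψ := by
  by_cases hb : b = 0
  · subst hb
    simp only [zero_mul, AddChar.map_zero_eq_one, mul_one, MulChar.map_zero]
    exact MulChar.sum_eq_zero_of_ne_one (quadraticCharComplex_ne_one hF)
  · have := gaussSum_mulShift_eq (quadraticCharComplex F) ψ (Units.mk0 b hb)
    rw [quadraticCharComplex_isQuadratic.inv] at this
    simpa [gaussSum, AddChar.mulShift_apply] using this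

/-- Grouping y by z = y², each z has 1 + η(z) square roots; the summand 1 contributes a full sum of
a nontrivial additive character, which is zero. -/
lemma sum_addChar_mul_sq (hF : ringChar F ≠ 2) {ψ : AddChar F ℂ} (hψ : ψ.IsPrimitive)
    {a : F} (ha : a ≠ 0) : ∑ y, ψ (a * y ^ 2) =
      quadraticCharComplex F a * gaussSum (quadraticCharComplex F) ψ := by
  have h1 : ∀ z : F, ∑ y ∈ Finset.univ.filter (fun y : F => y ^ 2 = z), ψ (a * y ^ 2) =
      quadraticCharComplex F z * ψ (a * z) + ψ (z * a) := by
    intro z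
    have h2 := quadraticChar_card_sqrts hF z
    have h3 : ((Finset.univ.filter (fun y : F => y ^ 2 = z)).card : ℂ) =
        quadraticCharComplex F z + 1 := by
      rw [quadraticCharComplex_apply]
      have : ({x : F | x ^ 2 = z}.toFinset) = Finset.univ.filter (fun y : F => y ^ 2 = z) := by
        ext; simp
      rw [this] at h2
      exact_mod_cast h2
    rw [Finset.sum_congr rfl (g := fun _ => ψ (a * z))]
    · rw [Finset.sum_const, nsmul_eq_mul, h3, mul_comm z a]; ring
    · intro y hy
      rw [(Finset.mem_filter.1 hy).2]
  rw [← Finset.sum_fiberwise Finset.univ (fun y : F => y ^ 2), Finset.sum_congr rfl fun z _ => h1 z,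
    Finset.sum_add_distrib, sum_quadraticCharComplex_mul hF, AddChar.sum_mulShift a hψ]
  simp [ha]

/-- Orthogonality of characters gives qN = ∑_t ∑_x ψ(t(Q(x) - c)). The term t = 0 is q^(2r+1). For t
≠ 0 the sum over x factors into Gauss sums, and since the number of variables is odd a factor η(t)
survives. Summing over t produces one more Gauss sum g, and g^(2r+2) = (η(-1)q)^(r+1). -/
lemma card_sum_mul_sq_eq (hF : ringChar F ≠ 2) {r : ℕ} (hι : Fintype.card ι = 2 * r + 1)
    (d : ι → F) (hd : ∏ i, d i ≠ 0) (c : F) :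
    ((Finset.univ.filter (fun x : ι → F => ∑ i, d i * x i ^ 2 = c)).card : ℂ) =
      (Fintype.card F : ℂ) ^ (2 * r) +
        (quadraticChar F ((-1) ^ r * (∏ i, d i) * c) : ℂ) * (Fintype.card F : ℂ) ^ r := by
  obtain ⟨ψ, hψ⟩ : ∃ ψ : AddChar F ℂ, ψ.IsPrimitive := ⟨AddChar.FiniteField.primitiveChar_to_Complex F,
    AddChar.FiniteField.primitiveChar_to_Complex_isPrimitive F⟩
  set η := quadraticCharComplex F with hη
  set g := gaussSum η ψ with hg
  set q : ℂ := (Fintype.card F : ℂ) with hq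
  have hq0 : q ≠ 0 := by simp [hq]
  have hg2 : g ^ 2 = η (-1) * q :=
    gaussSum_sq (quadraticCharComplex_ne_one hF) quadraticCharComplex_isQuadratic hψ
  have hprod : ∀ t : F, t ≠ 0 → ∑ x : ι → F, ψ (t * ∑ i, d i * x i ^ 2) =
      η (∏ i, d i) * g ^ (2 * r + 1) * η t := by
    intro t ht
    have h1 : ∀ x : ι → F, ψ (t * ∑ i, d i * x i ^ 2) = ∏ i, ψ ((t * d i) * x i ^ 2) := by
      intro x
      rw [Finset.mul_sum, addChar_sum]
      simp only [mul_assoc]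
    have h2 := Finset.prod_univ_sum (fun _ : ι => (Finset.univ : Finset F))
      (fun i y => ψ ((t * d i) * y ^ 2))
    rw [Fintype.piFinset_univ] at h2
    rw [Finset.sum_congr rfl fun x _ => h1 x, ← h2]
    rw [Finset.prod_congr rfl fun i _ => sum_addChar_mul_sq hF hψ
      (mul_ne_zero ht (Finset.prod_ne_zero_iff.1 hd i (Finset.mem_univ i)))]
    rw [Finset.prod_mul_distrib, Finset.prod_const, Finset.card_univ, hι, ← map_prod,
      Finset.prod_mul_distrib, Finset.prod_const, Finset.card_univ, hι, map_mul, map_pow,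
      pow_succ (η t), pow_mul]
    have : η t ^ 2 = 1 := by
      rw [hη, quadraticCharComplex_apply]
      exact_mod_cast quadraticChar_sq_one ht
    rw [this]; ring
  have hmain : ((Finset.univ.filter (fun x : ι → F => ∑ i, d i * x i ^ 2 = c)).card : ℂ) * q =
      q ^ (2 * r + 1) + η (∏ i, d i) * g ^ (2 * r + 1) * (η (-c) * g) := by
    have h1 : ∀ x : ι → F, ∑ t, ψ (t * (∑ i, d i * x i ^ 2 - c)) =
        if ∑ i, d i * x i ^ 2 = c then q else 0 := by
      intro x
      rw [AddChar.sum_mulShift _ hψ]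
      simp [sub_eq_zero, hq]
    have h2 : ∑ x : ι → F, ∑ t, ψ (t * (∑ i, d i * x i ^ 2 - c)) =
        ((Finset.univ.filter (fun x : ι → F => ∑ i, d i * x i ^ 2 = c)).card : ℂ) * q := by
      rw [Finset.sum_congr rfl fun x _ => h1 x, ← Finset.sum_filter, Finset.sum_const, nsmul_eq_mul]
    rw [← h2, Finset.sum_comm, ← Finset.add_sum_erase _ _ (Finset.mem_univ (0 : F))]
    congr 1
    · simp [hι, hq]
    · rw [← sum_quadraticCharComplex_mul hF ψ, ← Finset.add_sum_erase _ (fun t => η t * ψ (-c * t))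
        (Finset.mem_univ (0 : F))]
      simp only [MulChar.map_zero, zero_mul, zero_add]
      rw [Finset.mul_sum]
      refine Finset.sum_congr rfl fun t ht => ?_
      have ht0 := Finset.ne_of_mem_erase ht
      rw [← mul_assoc, ← hprod t ht0, Finset.sum_mul]
      refine Finset.sum_congr rfl fun x _ => ?_
      rw [← AddChar.map_add_eq_mul]
      congr 1; ring
  apply mul_right_cancel₀ hq0
  have h3 : g ^ (2 * r + 1) * g = (η (-1) * q) ^ (r + 1) := by
    rw [← hg2]; ring
  have h4 : (quadraticChar F ((-1) ^ r * (∏ i, d i) * c) : ℂ) =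
      η (-1) ^ r * η (∏ i, d i) * η c := by
    rw [← quadraticCharComplex_apply, map_mul, map_mul, map_pow]
  have h5 : η (-c) = η (-1) * η c := by rw [← map_mul]; simp
  have h6 : η (-1) * η (-1) = 1 := by
    rw [← map_mul]; simp
  rw [hmain, h4, h5, show η (∏ i, d i) * g ^ (2 * r + 1) * (η (-1) * η c * g) =
    η (∏ i, d i) * η (-1) * η c * (g ^ (2 * r + 1) * g) by ring, h3]
  linear_combination (η (-1)) ^ r * η (∏ i, d i) * η c * q ^ (r + 1) * h6

/-- The number of solutions of `Q = c` for a nondegenerate quadratic form `Q` in an odd number of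
variables over a finite field of odd characteristic. -/
theorem card_quadratic_eq (h2 : (2 : F) ≠ 0) {r : ℕ} (hι : Fintype.card ι = 2 * r + 1)
    (S : Matrix ι ι F) (hS : S.IsSymm) (hdet : S.det ≠ 0) (c : F) :
    ((Finset.univ.filter (fun x : ι → F => x ⬝ᵥ S *ᵥ x = c)).card : ℂ) =
      (Fintype.card F : ℂ) ^ (2 * r) +
        (quadraticChar F ((-1) ^ r * S.det * c) : ℂ) * (Fintype.card F : ℂ) ^ r := by
  have hF : ringChar F ≠ 2 := by
    intro h
    apply h2
    have := ringChar.Nat.cast_ringChar (R := F)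
    rw [h] at this
    exact_mod_cast this
  obtain ⟨P, d, hP, hPd⟩ := exists_mul_mul_transpose_eq_diagonal h2 S hS
  have hPdet : P.det ≠ 0 := ((Matrix.isUnit_iff_isUnit_det P).1 hP).ne_zero
  have hdd : ∏ i, d i = P.det ^ 2 * S.det := by
    rw [← det_diagonal, ← hPd, det_mul, det_mul, det_transpose]; ring
  -- Diagonalising multiplies the determinant by a nonzero square, invisible to the quadratic
  -- character.
  have hq : quadraticChar F ((-1) ^ r * (∏ i, d i) * c) =
      quadraticChar F ((-1) ^ r * S.det * c) := by
    rw [hdd, show (-1) ^ r * (P.det ^ 2 * S.det) * c = P.det ^ 2 * ((-1) ^ r * S.det * c) by ring,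
      map_mul, quadraticChar_sq_one' hPdet, one_mul]
  rw [← hq, ← card_sum_mul_sq_eq hF hι d (by rw [hdd]; exact mul_ne_zero (pow_ne_zero _ hPdet) hdet)]
  congr 1
  symm
  have := hP.invertible
  have key : ∀ x : ι → F, (x ᵥ* P) ⬝ᵥ S *ᵥ (x ᵥ* P) = ∑ i, d i * x i ^ 2 := by
    intro x
    rw [← mulVec_transpose, mulVec_mulVec, mulVec_transpose, ← dotProduct_mulVec,
      mulVec_mulVec, ← Matrix.mul_assoc, hPd]
    simp only [dotProduct, mulVec_diagonal]
    exact Finset.sum_congr rfl fun i _ => by ring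
  refine Finset.card_bij (fun x _ => x ᵥ* P) ?_ ?_ ?_
  · intro x hx
    simp only [Finset.mem_filter, Finset.mem_univ, true_and] at hx ⊢
    rw [key, hx]
  · intro x _ y _ h
    have := congrArg (fun z => z ᵥ* P⁻¹) h
    simpa [vecMul_vecMul] using this
  · intro y hy
    refine ⟨y ᵥ* P⁻¹, ?_, by simp [vecMul_vecMul]⟩
    simp only [Finset.mem_filter, Finset.mem_univ, true_and] at hy ⊢
    rw [← key]
    simpa [vecMul_vecMul] using hy

end FiniteFieldCount

/-! ### Residue field, value group and square roots in a local field. -/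

section LocalField

variable {k : Type*} [NontriviallyNormedField k] [IsUltrametricDist k]

lemma mem_intRing_iff {x : k} : x ∈ IntRing k ↔ ‖x‖ ≤ 1 := Valued.integer.mem_iff

lemma norm_intRing_le (x : IntRing k) : ‖(x : k)‖ ≤ 1 := mem_intRing_iff.1 x.2

lemma residue_eq_zero_iff_norm_lt (x : IntRing k) :
    IsLocalRing.residue (IntRing k) x = 0 ↔ ‖(x : k)‖ < 1 := by
  rw [IsLocalRing.residue_eq_zero_iff, IsLocalRing.mem_maximalIdeal, mem_nonunits_iff,
    Valued.integer.isUnit_iff_norm_eq_one]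
  exact ⟨fun h => lt_of_le_of_ne (norm_intRing_le x) h, fun h => h.ne⟩

lemma residue_eq_iff_norm_sub_lt (x y : IntRing k) :
    IsLocalRing.residue (IntRing k) x = IsLocalRing.residue (IntRing k) y ↔
      ‖(x : k) - y‖ < 1 := by
  rw [← sub_eq_zero, ← map_sub, residue_eq_zero_iff_norm_lt]
  simp

lemma norm_two (h2 : IsUnit (2 : IntRing k)) : ‖(2 : k)‖ = 1 :=
  Valued.integer.isUnit_iff_norm_eq_one.1 h2

lemma residue_two_ne_zero (h2 : IsUnit (2 : IntRing k)) :
    (2 : IsLocalRing.ResidueField (IntRing k)) ≠ 0 := by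
  have := (h2.map (IsLocalRing.residue (IntRing k))).ne_zero
  rwa [map_ofNat] at this

lemma norm_eq_of_norm_sub_lt {E : Type*} [SeminormedAddCommGroup E] [IsUltrametricDist E] {x y : E}
    (h : ‖x - y‖ < ‖y‖) : ‖x‖ = ‖y‖ := by
  rw [← norm_neg y]
  apply IsUltrametricDist.norm_eq_of_add_norm_lt_max
  rw [← sub_eq_add_neg, norm_neg]
  exact lt_max_of_lt_right h

lemma norm_sub_le_max {E : Type*} [SeminormedAddCommGroup E] [IsUltrametricDist E] (x y : E) :
    ‖x - y‖ ≤ max ‖x‖ ‖y‖ := by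
  rw [sub_eq_add_neg, ← norm_neg y]
  exact IsUltrametricDist.norm_add_le_max _ _

variable (k) in
lemma norm_valuation_rankOne_nonempty : Nonempty (Valued.v (R := k)).RankOne :=
  ⟨inferInstanceAs (NormedField.valuation (K := k)).RankOne⟩

variable [LocallyCompactSpace k]

lemma properSpace_of_locallyCompact {k : Type*} [NontriviallyNormedField k]
    [LocallyCompactSpace k] : ProperSpace k :=
  .of_nontriviallyNormedField_of_weaklyLocallyCompactSpace k

lemma intRing_compactSpace : CompactSpace (IntRing k) := by
  have := properSpace_of_locallyCompact (k := k)
  have h : ((IntRing k : Subring k) : Set k) = Metric.closedBall 0 1 := by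
    ext x; simp [mem_intRing_iff]
  exact isCompact_iff_compactSpace.1 (h ▸ isCompact_closedBall (0 : k) 1)

lemma intRing_isDVR : IsDiscreteValuationRing (IntRing k) := by
  have := intRing_compactSpace (k := k)
  obtain ⟨_⟩ := norm_valuation_rankOne_nonempty k
  exact Valued.integer.isDiscreteValuationRing_of_compactSpace

lemma finite_residueField : Finite (IsLocalRing.ResidueField (IntRing k)) := by
  have := intRing_compactSpace (k := k)
  obtain ⟨_⟩ := norm_valuation_rankOne_nonempty k
  exact (Valued.integer.compactSpace_iff_completeSpace_and_isDiscreteValuationRing_and_finite_residueField.1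
    this).2.2

variable (k) in
lemma one_lt_resCard : 1 < resCard k := by
  have := finite_residueField (k := k)
  exact Finite.one_lt_card

lemma exists_uniformizer (hk : IsNormalized k) :
    ∃ ϖ : k, ‖ϖ‖ = (resCard k : ℝ)⁻¹ ∧ ∀ x : k, x ≠ 0 → ∃ m : ℤ, ‖x‖ = (resCard k : ℝ) ^ m := by
  have := intRing_isDVR (k := k)
  obtain ⟨ϖ, hϖ⟩ := IsDiscreteValuationRing.exists_irreducible (IntRing k)
  have hint : ∀ x : IntRing k, (x : k) ≠ 0 → ∃ m : ℤ, ‖(x : k)‖ = (resCard k : ℝ) ^ m := by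
    intro x hx
    obtain ⟨n, u, hu⟩ := IsDiscreteValuationRing.eq_unit_mul_pow_irreducible
      (x := x) (by simpa using hx) hϖ
    refine ⟨-n, ?_⟩
    rw [hu]
    have h1 : ‖((u : IntRing k) : k)‖ = 1 := Valued.integer.norm_coe_unit u
    push_cast
    rw [norm_mul, norm_pow, h1, hk ϖ hϖ]
    simp
  refine ⟨ϖ, hk ϖ hϖ, fun x hx => ?_⟩
  rcases le_total ‖x‖ 1 with h | h
  · exact hint ⟨x, mem_intRing_iff.2 h⟩ hx
  · obtain ⟨m, hm⟩ := hint ⟨x⁻¹, mem_intRing_iff.2 (by rw [norm_inv]; exact inv_le_one_of_one_le₀ h)⟩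
      (inv_ne_zero hx)
    refine ⟨-m, ?_⟩
    rw [_root_.zpow_neg, ← hm]
    simp

/-- The nonzero norms are integral powers of q, so a strict inequality gains a factor q. -/
lemma norm_le_zpow_of_lt (hk : IsNormalized k) {x : k} {m : ℤ} (h : ‖x‖ < (resCard k : ℝ) ^ m) :
    ‖x‖ ≤ (resCard k : ℝ) ^ (m - 1) := by
  have hq : (1 : ℝ) < resCard k := by exact_mod_cast one_lt_resCard k
  by_cases hx : x = 0
  · subst hx; simp; positivity
  · obtain ⟨_, -, h'⟩ := exists_uniformizer hk
    obtain ⟨j, hj⟩ := h' x hx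
    rw [hj] at h ⊢
    have := (zpow_lt_zpow_iff_right₀ hq).1 h
    exact zpow_le_zpow_right₀ hq.le (by omega)

/-- Square roots in the group of principal units. -/
lemma exists_sqrt_of_norm_sub_one_lt (h2 : IsUnit (2 : IntRing k)) {a : k} (ha : ‖a - 1‖ < 1) :
    ∃ t : k, ‖t - 1‖ < 1 ∧ t ^ 2 = a := by
  have := properSpace_of_locallyCompact (k := k)
  have h2n := norm_two h2
  have h20 : (2 : k) ≠ 0 := norm_ne_zero_iff.1 (by rw [h2n]; exact one_ne_zero)
  set s : Set k := Metric.closedBall 1 ‖a - 1‖ with hs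
  -- Newton's iteration with the derivative frozen at its value 2 at t = 1. It contracts the closed
  -- ball of radius ‖a - 1‖ about 1 by the factor ‖a - 1‖.
  let f : k → k := fun t => t - (t ^ 2 - a) / 2
  have hdiff : ∀ t ∈ s, ∀ u ∈ s, ‖f t - f u‖ ≤ ‖a - 1‖ * ‖t - u‖ := by
    intro t ht u hu
    rw [hs, mem_closedBall_iff_norm] at ht hu
    have h1 : f t - f u = -((t - 1) + (u - 1)) / 2 * (t - u) := by
      simp only [f]; field_simp; ring
    rw [h1, norm_mul, norm_div, norm_neg, h2n, div_one]
    gcongr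
    exact (IsUltrametricDist.norm_add_le_max _ _).trans (max_le ht hu)
  have hmaps : Set.MapsTo f s s := by
    intro t ht
    have h1 : (1 : k) ∈ s := by simp [hs]
    have h3 := hdiff t ht 1 h1
    rw [hs, mem_closedBall_iff_norm] at ht ⊢
    have h4 : f t - 1 = (f t - f 1) + (a - 1) / 2 := by
      simp only [f]; field_simp; ring
    rw [h4]
    refine (IsUltrametricDist.norm_add_le_max _ _).trans (max_le (h3.trans ?_) ?_)
    · nlinarith [norm_nonneg (t - 1), norm_nonneg (a - 1)]
    · rw [norm_div, h2n, div_one]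
  have hcontr : ContractingWith ‖a - 1‖₊ (hmaps.restrict f s s) := by
    refine ⟨by exact_mod_cast ha, LipschitzWith.of_dist_le_mul fun t u => ?_⟩
    rw [Subtype.dist_eq, Subtype.dist_eq, dist_eq_norm, dist_eq_norm]
    exact hdiff t t.2 u u.2
  have h1 : (1 : k) ∈ s := by simp [hs]
  obtain ⟨t, hts, hfix, -⟩ := hcontr.exists_fixedPoint' (Metric.isClosed_closedBall.isComplete) hmaps
    h1 (edist_ne_top _ _)
  refine ⟨t, ?_, ?_⟩
  · rw [hs, mem_closedBall_iff_norm] at hts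
    exact hts.trans_lt ha
  · have h5 : t - (t ^ 2 - a) / 2 = t := hfix
    have h6 : (t ^ 2 - a) / 2 = 0 := by linear_combination -h5
    rw [div_eq_zero_iff] at h6
    exact sub_eq_zero.1 (h6.resolve_right h20)

/-- If u ≡ a² then u/a² is a principal unit and so has a square root. -/
lemma isSquare_iff_isSquare_residue (h2 : IsUnit (2 : IntRing k)) {u : IntRing k} (hu : IsUnit u) :
    IsSquare u ↔ IsSquare (IsLocalRing.residue (IntRing k) u) := by
  refine ⟨fun h => h.map _, ?_⟩
  rintro ⟨b, hb⟩
  obtain ⟨a, rfl⟩ := IsLocalRing.residue_surjective b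
  have hun : ‖(u : k)‖ = 1 := Valued.integer.isUnit_iff_norm_eq_one.1 hu
  rw [← map_mul, residue_eq_iff_norm_sub_lt] at hb
  push_cast at hb
  have ha1 : ‖(a : k) * a‖ = 1 := by
    rw [← hun]
    refine norm_eq_of_norm_sub_lt ?_
    rwa [norm_sub_rev, hun]
  have haa : (a : k) * a ≠ 0 := norm_ne_zero_iff.1 (by rw [ha1]; exact one_ne_zero)
  obtain ⟨t, -, ht⟩ := exists_sqrt_of_norm_sub_one_lt h2 (a := u / (a * a)) (by
    rw [div_sub_one haa, norm_div, ha1, div_one]; exact hb)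
  have hts : (u : k) = (t * a) * (t * a) := by
    rw [eq_div_iff haa] at ht
    rw [← ht]; ring
  have hta : ‖t * a‖ = 1 := by
    have : ‖t * a‖ * ‖t * a‖ = 1 := by rw [← norm_mul, ← hts, hun]
    nlinarith [norm_nonneg (t * a)]
  refine ⟨⟨t * a, mem_intRing_iff.2 hta.le⟩, Subtype.ext ?_⟩
  simpa using hts

end LocalField

/-! ### Algebra of quadratic forms. -/

section QuadForm

variable {ι : Type*} [Fintype ι] {R : Type*} [CommRing R]

/-- The value at `v` of the quadratic form with Gram matrix `S`. -/
def quadForm (S : Matrix ι ι R) (v : ι → R) : R := v ⬝ᵥ S *ᵥ v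

lemma dotProduct_mulVec_comm_of_isSymm {S : Matrix ι ι R} (hS : S.IsSymm) (v w : ι → R) :
    v ⬝ᵥ S *ᵥ w = w ⬝ᵥ S *ᵥ v := by
  rw [dotProduct_mulVec, dotProduct_comm, ← mulVec_transpose, hS.eq]

lemma quadForm_add {S : Matrix ι ι R} (hS : S.IsSymm) (v w : ι → R) :
    quadForm S (v + w) = quadForm S v + 2 * (w ⬝ᵥ S *ᵥ v) + quadForm S w := by
  simp only [quadForm, mulVec_add, add_dotProduct, dotProduct_add]
  rw [dotProduct_mulVec_comm_of_isSymm hS v w]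
  ring

lemma quadForm_add_single [DecidableEq ι] {S : Matrix ι ι R} (hS : S.IsSymm) (v : ι → R) (i : ι) (t : R) :
    quadForm S (v + Pi.single i t) = quadForm S v + 2 * t * (S *ᵥ v) i + t ^ 2 * S i i := by
  rw [quadForm_add hS]
  simp [quadForm]
  ring

lemma quadForm_smul (S : Matrix ι ι R) (c : R) (v : ι → R) :
    quadForm S (c • v) = c ^ 2 * quadForm S v := by
  simp [quadForm, mulVec_smul]
  ring

lemma map_quadForm {R' : Type*} [CommRing R'] (f : R →+* R') (S : Matrix ι ι R) (v : ι → R) :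
    f (quadForm S v) = quadForm (S.map f) (fun i => f (v i)) := by
  simp [quadForm, dotProduct, mulVec]

end QuadForm

/-! ### Hensel's lemma for volumes. -/

section Volumes

variable {k : Type*} [NontriviallyNormedField k] [IsUltrametricDist k]
  {ι : Type*} [Fintype ι]

/-- The matrix over `k` underlying an integral matrix. -/
def integralMatrix (S : Matrix ι ι (IntRing k)) : Matrix ι ι k := S.map (fun x => (x : k))

/-- The reduction of an integral matrix. -/
noncomputable def residueMatrix (S : Matrix ι ι (IntRing k)) :
    Matrix ι ι (IsLocalRing.ResidueField (IntRing k)) :=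
  S.map (IsLocalRing.residue (IntRing k))

lemma quadForm_integralMatrix (S : Matrix ι ι (IntRing k)) (w : ι → IntRing k) :
    quadForm (integralMatrix S) (fun i => (w i : k)) = (quadForm S w : IntRing k) :=
  (map_quadForm (IntRing k).subtype S w).symm

lemma norm_integralMatrix_mulVec_le (S : Matrix ι ι (IntRing k)) (u : ι → k) (i : ι) :
    ‖(integralMatrix S *ᵥ u) i‖ ≤ ‖u‖ := by
  refine IsUltrametricDist.norm_sum_le_of_forall_le_of_nonneg (norm_nonneg u) fun j _ => ?_
  rw [norm_mul]
  calc _ ≤ 1 * ‖u‖ := by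
        gcongr
        · exact norm_intRing_le (S i j)
        · exact norm_le_pi_norm u j
    _ = ‖u‖ := one_mul _

/-- A representative in `k^ι` of a vector over the residue field. -/
noncomputable def residueLift (y : ι → IsLocalRing.ResidueField (IntRing k)) : ι → IntRing k :=
  fun i => Function.surjInv IsLocalRing.residue_surjective (y i)

lemma residue_residueLift {ι : Type*} (y : ι → IsLocalRing.ResidueField (IntRing k)) (i : ι) :
    IsLocalRing.residue (IntRing k) (residueLift y i) = y i :=
  Function.surjInv_eq _ _

/-- The vectors with given reduction. -/
def residueBall (y : ι → IsLocalRing.ResidueField (IntRing k)) : Set (ι → k) :=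
  Metric.ball (fun i => (residueLift y i : k)) 1

lemma coe_mem_residueBall_iff (w : ι → IntRing k) (y : ι → IsLocalRing.ResidueField (IntRing k)) :
    (fun i => (w i : k)) ∈ residueBall y ↔ ∀ i, IsLocalRing.residue (IntRing k) (w i) = y i := by
  rw [residueBall, mem_ball_iff_norm, pi_norm_lt_iff zero_lt_one]
  refine forall_congr' fun i => ?_
  conv_rhs => rw [← residue_residueLift y i]
  rw [residue_eq_iff_norm_sub_lt]
  rfl

lemma exists_coe_eq_of_norm_le_one {v : ι → k} (hv : ‖v‖ ≤ 1) :
    ∃ w : ι → IntRing k, v = fun i => (w i : k) :=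
  ⟨fun i => ⟨v i, mem_intRing_iff.2 ((norm_le_pi_norm v i).trans hv)⟩, rfl⟩

lemma norm_coe_le_one (w : ι → IntRing k) : ‖fun i => (w i : k)‖ ≤ 1 :=
  (pi_norm_le_iff_of_nonneg zero_le_one).2 fun i => norm_intRing_le (w i)

lemma norm_le_one_of_mem_residueBall {y : ι → IsLocalRing.ResidueField (IntRing k)} {v : ι → k}
    (hv : v ∈ residueBall y) : ‖v‖ ≤ 1 := by
  rw [residueBall, mem_ball_iff_norm] at hv
  have : v = (v - fun i => (residueLift y i : k)) + fun i => (residueLift y i : k) := by abel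
  rw [this]
  exact (IsUltrametricDist.norm_add_le_max _ _).trans (max_le hv.le (norm_coe_le_one _))

lemma exists_mem_residueBall {v : ι → k} (hv : ‖v‖ ≤ 1) :
    ∃ y : ι → IsLocalRing.ResidueField (IntRing k), v ∈ residueBall y := by
  obtain ⟨w, rfl⟩ := exists_coe_eq_of_norm_le_one hv
  exact ⟨_, (coe_mem_residueBall_iff w _).2 fun i => rfl⟩

lemma eq_of_mem_residueBall {y z : ι → IsLocalRing.ResidueField (IntRing k)} {v : ι → k}
    (hy : v ∈ residueBall y) (hz : v ∈ residueBall z) : y = z := by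
  obtain ⟨w, rfl⟩ := exists_coe_eq_of_norm_le_one (norm_le_one_of_mem_residueBall hy)
  rw [coe_mem_residueBall_iff] at hy hz
  exact funext fun i => (hy i).symm.trans (hz i)

lemma norm_lt_one_iff_of_mem_residueBall {y : ι → IsLocalRing.ResidueField (IntRing k)} {v : ι → k}
    (hy : v ∈ residueBall y) : ‖v‖ < 1 ↔ y = 0 := by
  obtain ⟨w, rfl⟩ := exists_coe_eq_of_norm_le_one (norm_le_one_of_mem_residueBall hy)
  rw [coe_mem_residueBall_iff] at hy
  rw [pi_norm_lt_iff zero_lt_one, funext_iff]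
  refine forall_congr' fun i => ?_
  rw [← residue_eq_zero_iff_norm_lt, hy i]
  rfl

lemma norm_quadForm_sub_lt_one_iff (S : Matrix ι ι (IntRing k))
    {y : ι → IsLocalRing.ResidueField (IntRing k)} {v : ι → k} (hv : v ∈ residueBall y)
    (c : IntRing k) :
    ‖quadForm (integralMatrix S) v - c‖ < 1 ↔
      quadForm (residueMatrix S) y = IsLocalRing.residue (IntRing k) c := by
  obtain ⟨w, rfl⟩ := exists_coe_eq_of_norm_le_one (norm_le_one_of_mem_residueBall hv)
  rw [coe_mem_residueBall_iff] at hv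
  rw [quadForm_integralMatrix, ← residue_eq_iff_norm_sub_lt, map_quadForm, residueMatrix]
  simp only [hv]

lemma continuous_quadForm (S : Matrix ι ι k) : Continuous (quadForm S) := by
  unfold quadForm
  fun_prop

section Haar

variable [ProperSpace k] [MeasurableSpace k] [BorelSpace k] (m : Measure (ι → k)) [m.IsAddHaarMeasure]

lemma measurableSet_residueBall (y : ι → IsLocalRing.ResidueField (IntRing k)) :
    MeasurableSet (residueBall y) :=
  Metric.isOpen_ball.measurableSet

lemma measure_residueBall (y : ι → IsLocalRing.ResidueField (IntRing k)) :
    m (residueBall y) = m (Metric.ball 0 1) := by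
  rw [← measure_preimage_add m (fun i => (residueLift y i : k)) (residueBall y)]
  congr 1
  ext v
  simp [residueBall]

lemma measure_eq_sum_residueBall [Finite (IsLocalRing.ResidueField (IntRing k))]
    {E : Set (ι → k)} (hE : MeasurableSet E)
    (T : Finset (ι → IsLocalRing.ResidueField (IntRing k)))
    (hT : ∀ v ∈ E, ∃ y ∈ T, v ∈ residueBall y) :
    m E = ∑ y ∈ T, m (residueBall y ∩ E) := by
  rw [← measure_biUnion_finset]
  · congr 1
    ext v
    simp only [Set.mem_iUnion, Set.mem_inter_iff, exists_prop]
    exact ⟨fun h => (hT v h).imp fun y hy => ⟨hy.1, hy.2, h⟩, fun ⟨_, _, _, h⟩ => h⟩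
  · intro y _ z _ hyz
    refine Set.disjoint_left.2 fun v hv hv' => hyz (eq_of_mem_residueBall hv.1 hv'.1)
  · exact fun y _ => (measurableSet_residueBall y).inter hE

/-- On the residue class y the partial derivative 2(Sv)ᵢ is a unit. Moving the i-th coordinate by a
suitable t therefore shifts the form by δ up to an error smaller than a, and Haar measure does not
notice the translation. -/
lemma measure_residueBall_inter_translate [DecidableEq ι] {S : Matrix ι ι (IntRing k)} (hS : S.IsSymm)
    (h2 : IsUnit (2 : IntRing k)) {y : ι → IsLocalRing.ResidueField (IntRing k)} {i : ι}
    (hi : (residueMatrix S *ᵥ y) i ≠ 0) (c : k) {δ : k} {a : ℝ} (ha0 : 0 < a) (ha : a < 1)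
    (hδ : ‖δ‖ ≤ a) :
    m (residueBall y ∩ {v | ‖quadForm (integralMatrix S) v - (c + δ)‖ < a}) =
      m (residueBall y ∩ {v | ‖quadForm (integralMatrix S) v - c‖ < a}) := by
  set y₀ : ι → k := fun i => (residueLift y i : k) with hy₀
  have hSk : (integralMatrix S).IsSymm := by
    ext a b
    have := congrFun (congrFun hS.eq a) b
    simp only [transpose_apply] at this
    simp [integralMatrix, this]
  set g := (integralMatrix S *ᵥ y₀) i with hg
  have hg1 : ‖g‖ = 1 := by
    have h1 : g = ((S *ᵥ residueLift y) i : IntRing k) := by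
      simp [hg, hy₀, mulVec, dotProduct, integralMatrix]
    have h3 : IsLocalRing.residue (IntRing k) ((S *ᵥ residueLift y) i) ≠ 0 := by
      have : IsLocalRing.residue (IntRing k) ((S *ᵥ residueLift y) i) =
          (residueMatrix S *ᵥ y) i := by
        simp [mulVec, dotProduct, residueMatrix, residue_residueLift]
      rwa [this]
    rw [Ne, residue_eq_zero_iff_norm_lt, not_lt] at h3
    rw [h1]
    exact le_antisymm (norm_intRing_le _) h3
  have hg0 : g ≠ 0 := norm_ne_zero_iff.1 (by rw [hg1]; exact one_ne_zero)
  have h2n := norm_two h2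
  have h20 : (2 : k) ≠ 0 := norm_ne_zero_iff.1 (by rw [h2n]; exact one_ne_zero)
  -- The first-order solution of Q(v + t eᵢ) = Q(v) + δ, with the derivative taken at the chosen
  -- representative of y.
  set t : k := δ / (2 * g) with ht
  have htn : ‖t‖ = ‖δ‖ := by rw [ht, norm_div, norm_mul, h2n, hg1]; simp
  have htδ : 2 * t * g = δ := by rw [ht]; field_simp
  have htS : ‖(Pi.single i t : ι → k)‖ < 1 := by
    rw [Pi.norm_single, htn]; exact hδ.trans_lt ha
  rw [← measure_preimage_add_right m (Pi.single i t)]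
  congr 1
  ext v
  simp only [Set.mem_preimage, Set.mem_inter_iff, Set.mem_ofPred_eq]
  have hball : v + Pi.single i t ∈ residueBall y ↔ v ∈ residueBall y := by
    simp only [residueBall, mem_ball_iff_norm]
    constructor
    · intro h
      have : v - y₀ = (v + Pi.single i t - y₀) - Pi.single i t := by abel
      rw [this]
      exact (norm_sub_le_max _ _).trans_lt (max_lt h htS)
    · intro h
      have : v + Pi.single i t - y₀ = (v - y₀) + Pi.single i t := by abel
      rw [this]
      exact (IsUltrametricDist.norm_add_le_max _ _).trans_lt (max_lt h htS)
  rw [hball]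
  refine and_congr_right fun hv => ?_
  -- The error: the variation of the derivative over the residue class, of norm < 1 and multiplied
  -- by t, plus the quadratic term, of norm at most a² < a.
  set e : k := 2 * t * ((integralMatrix S *ᵥ (v - y₀)) i) + t ^ 2 * integralMatrix S i i with he
  have hQ : quadForm (integralMatrix S) (v + Pi.single i t) - (c + δ) =
      quadForm (integralMatrix S) v - c + e := by
    rw [quadForm_add_single hSk, he, mulVec_sub, Pi.sub_apply, ← hg]
    linear_combination htδ
  have hen : ‖e‖ < a := by
    refine (IsUltrametricDist.norm_add_le_max _ _).trans_lt (max_lt ?_ ?_)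
    · rw [norm_mul, norm_mul, h2n, one_mul, htn]
      have h1 : ‖(integralMatrix S *ᵥ (v - y₀)) i‖ < 1 :=
        (norm_integralMatrix_mulVec_le S _ i).trans_lt (by
          rwa [residueBall, mem_ball_iff_norm] at hv)
      calc _ ≤ a * ‖(integralMatrix S *ᵥ (v - y₀)) i‖ := by gcongr
        _ < a * 1 := by gcongr
        _ = a := mul_one a
    · rw [norm_mul, norm_pow, htn]
      have h1 : ‖integralMatrix S i i‖ ≤ 1 := norm_intRing_le (S i i)
      calc _ ≤ a ^ 2 * 1 := by gcongr
        _ < a := by nlinarith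
  rw [hQ]
  constructor
  · intro h
    have h3 : quadForm (integralMatrix S) v - c = (quadForm (integralMatrix S) v - c + e) - e := by
      ring
    rw [h3]
    exact (norm_sub_le_max _ _).trans_lt (max_lt h hen)
  · intro h
    exact (IsUltrametricDist.norm_add_le_max _ _).trans_lt (max_lt h hen)

/-- On the vectors with a given reduction at which the form is smooth, the values of the form are
uniformly distributed. -/
lemma pow_mul_measure_residueBall_inter [DecidableEq ι] (hk : IsNormalized k) {S : Matrix ι ι (IntRing k)}
    (hS : S.IsSymm) (h2 : IsUnit (2 : IntRing k)) {y : ι → IsLocalRing.ResidueField (IntRing k)}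
    {i : ι} (hi : (residueMatrix S *ᵥ y) i ≠ 0) (c : IntRing k)
    (hc : quadForm (residueMatrix S) y = IsLocalRing.residue (IntRing k) c) (j : ℕ) :
    (resCard k : ENNReal) ^ j * m (residueBall y ∩
      {v | ‖quadForm (integralMatrix S) v - c‖ < ((resCard k : ℝ)⁻¹) ^ j}) =
      m (Metric.ball 0 1) := by
  have hq : (1 : ℝ) < resCard k := by exact_mod_cast one_lt_resCard k
  have : Finite (IsLocalRing.ResidueField (IntRing k)) := finite_residueField
  have := Fintype.ofFinite (IsLocalRing.ResidueField (IntRing k))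
  obtain ⟨ϖ, hϖ, -⟩ := exists_uniformizer hk
  induction j with
  | zero =>
    rw [pow_zero, pow_zero, one_mul, ← measure_residueBall m y]
    congr 1
    rw [Set.inter_eq_left]
    exact fun v hv => (norm_quadForm_sub_lt_one_iff S hv c).2 hc
  | succ j ih =>
    rw [← ih, pow_succ, mul_assoc]
    congr 1
    set a : ℝ := ((resCard k : ℝ)⁻¹) ^ (j + 1) with ha
    have ha0 : 0 < a := by positivity
    have ha1 : a < 1 := pow_lt_one₀ (by positivity) (inv_lt_one_of_one_lt₀ hq) (by omega)
    have hπ : ‖ϖ ^ (j + 1)‖ = a := by rw [norm_pow, hϖ]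
    have hπ0 : ϖ ^ (j + 1) ≠ 0 := norm_ne_zero_iff.1 (by rw [hπ]; exact ha0.ne')
    let l : IsLocalRing.ResidueField (IntRing k) → IntRing k := fun z =>
      Function.surjInv IsLocalRing.residue_surjective z
    have hl : ∀ z, IsLocalRing.residue (IntRing k) (l z) = z := fun z => Function.surjInv_eq _ _
    -- A strict bound by q^(-j) is a bound by q^(-(j+1)), so the tube splits into q thinner tubes
    -- indexed by the next digit z of the value. All have equal measure by the translation lemma.
    have hunion : residueBall y ∩ {v | ‖quadForm (integralMatrix S) v - c‖ < ((resCard k : ℝ)⁻¹) ^ j}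
        = ⋃ z ∈ (Finset.univ : Finset (IsLocalRing.ResidueField (IntRing k))), residueBall y ∩
          {v | ‖quadForm (integralMatrix S) v - (c + ϖ ^ (j + 1) * l z)‖ < a} := by
      ext v
      simp only [Set.mem_inter_iff, Set.mem_ofPred_eq, Set.mem_iUnion, Finset.mem_univ, exists_prop,
        true_and, exists_and_left]
      refine and_congr_right fun _ => ⟨fun h => ?_, ?_⟩
      · have h1 : ‖quadForm (integralMatrix S) v - c‖ ≤ a := by
          have := norm_le_zpow_of_lt hk (m := -(j : ℤ)) (by simpa using h)
          rw [ha, inv_pow, ← zpow_natCast, ← _root_.zpow_neg]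
          convert this using 2
          push_cast; ring
        have h3 : ‖(quadForm (integralMatrix S) v - c) / ϖ ^ (j + 1)‖ ≤ 1 := by
          rw [norm_div, hπ]; exact div_le_one_of_le₀ h1 ha0.le
        refine ⟨IsLocalRing.residue _ ⟨_, mem_intRing_iff.2 h3⟩, ?_⟩
        have h4 := (residue_eq_iff_norm_sub_lt ⟨_, mem_intRing_iff.2 h3⟩ _).1
          (hl (IsLocalRing.residue _ ⟨_, mem_intRing_iff.2 h3⟩)).symm
        simp only at h4
        rw [← sub_sub]
        calc _ = ‖ϖ ^ (j + 1)‖ * ‖(quadForm (integralMatrix S) v - c) / ϖ ^ (j + 1) -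
              l (IsLocalRing.residue _ ⟨_, mem_intRing_iff.2 h3⟩)‖ := by
                rw [← norm_mul]; congr 1; field_simp
          _ < a * 1 := by rw [hπ]; gcongr
          _ = a := mul_one a
      · rintro ⟨z, hz⟩
        have h1 : quadForm (integralMatrix S) v - c =
          (quadForm (integralMatrix S) v - (c + ϖ ^ (j + 1) * l z)) + ϖ ^ (j + 1) * l z := by ring
        have h3 : a < ((resCard k : ℝ)⁻¹) ^ j := by
          rw [ha, pow_succ]
          exact mul_lt_of_lt_one_right (by positivity) (inv_lt_one_of_one_lt₀ hq)
        rw [h1]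
        refine (IsUltrametricDist.norm_add_le_max _ _).trans_lt (max_lt (hz.trans h3) ?_)
        rw [norm_mul, hπ]
        exact (mul_le_of_le_one_right ha0.le (norm_intRing_le _)).trans_lt h3
    rw [hunion, measure_biUnion_finset]
    · rw [Finset.sum_congr rfl fun z _ => measure_residueBall_inter_translate m hS h2 hi (c : k) ha0
        ha1 (δ := ϖ ^ (j + 1) * l z) (by
          rw [norm_mul, hπ]; exact mul_le_of_le_one_right ha0.le (norm_intRing_le _))]
      rw [Finset.sum_const, nsmul_eq_mul, Finset.card_univ, resCard, Nat.card_eq_fintype_card]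
    · intro z _ z' _ hzz
      refine Set.disjoint_left.2 fun v hv hv' => hzz ?_
      rw [← hl z, ← hl z', residue_eq_iff_norm_sub_lt]
      have h1 := hv.2
      have h3 := hv'.2
      simp only [Set.mem_ofPred_eq] at h1 h3
      have h4 : ϖ ^ (j + 1) * ((l z : k) - l z') =
          (quadForm (integralMatrix S) v - (c + ϖ ^ (j + 1) * l z')) -
          (quadForm (integralMatrix S) v - (c + ϖ ^ (j + 1) * l z)) := by ring
      have h5 : ‖ϖ ^ (j + 1) * ((l z : k) - l z')‖ < a := by
        rw [h4]
        exact (norm_sub_le_max _ _).trans_lt (max_lt h3 h1)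
      rw [norm_mul, hπ] at h5
      by_contra h6
      rw [not_lt] at h6
      nlinarith
    · intro z _
      refine (measurableSet_residueBall y).inter ?_
      exact (isOpen_lt (by have := continuous_quadForm (integralMatrix S); fun_prop)
        continuous_const).measurableSet

end Haar

end Volumes

/-! ### Volumes of the shells of the cone. -/

section LevelSets

variable {k : Type*} [NontriviallyNormedField k] [IsUltrametricDist k]
  {ι : Type*} [Fintype ι]

lemma quadraticChar_residue_eq_quadChar [ProperSpace k] (h2 : IsUnit (2 : IntRing k))
    [Fintype (IsLocalRing.ResidueField (IntRing k))]
    [DecidableEq (IsLocalRing.ResidueField (IntRing k))] {u : IntRing k} (hu : IsUnit u) :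
    (quadraticChar (IsLocalRing.ResidueField (IntRing k))
      (IsLocalRing.residue (IntRing k) u) : ℂ) = quadChar u := by
  have h0 : IsLocalRing.residue (IntRing k) u ≠ 0 := (hu.map _).ne_zero
  rw [quadChar, isSquare_iff_isSquare_residue h2 hu]
  split_ifs with h
  · rw [(quadraticChar_one_iff_isSquare h0).2 h]; simp
  · rw [quadraticChar_neg_one_iff_not_isSquare.2 h]; simp

/-- The vectors of norm `q ^ j` on which the quadratic form is a principal unit. -/
def levelSet (S : Matrix ι ι (IntRing k)) (j : ℕ) : Set (ι → k) :=
  {v | ‖v‖ = (resCard k : ℝ) ^ j ∧ ‖quadForm (integralMatrix S) v - 1‖ < 1}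

variable [ProperSpace k] [MeasurableSpace k] [BorelSpace k]

lemma measurableSet_levelSet (S : Matrix ι ι (IntRing k)) (j : ℕ) :
    MeasurableSet (levelSet S j) := by
  have := continuous_quadForm (integralMatrix S)
  refine MeasurableSet.inter (s₁ := {v | ‖v‖ = (resCard k : ℝ) ^ j})
    (s₂ := {v | ‖quadForm (integralMatrix S) v - 1‖ < 1})
    (isClosed_eq continuous_norm continuous_const).measurableSet
    (isOpen_lt ?_ continuous_const).measurableSet
  fun_prop

variable (m : Measure (ι → k)) [m.IsAddHaarMeasure]

lemma measure_closedBall_one :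
    m (Metric.closedBall 0 1) = (resCard k : ENNReal) ^ Fintype.card ι * m (Metric.ball 0 1) := by
  classical
  have : Finite (IsLocalRing.ResidueField (IntRing k)) := finite_residueField
  have := Fintype.ofFinite (IsLocalRing.ResidueField (IntRing k))
  rw [measure_eq_sum_residueBall m Metric.isClosed_closedBall.measurableSet Finset.univ
    (fun v hv => by
      obtain ⟨y, hy⟩ := exists_mem_residueBall (mem_closedBall_zero_iff.1 hv)
      exact ⟨y, Finset.mem_univ y, hy⟩)]
  rw [Finset.sum_congr rfl (g := fun _ => m (Metric.ball 0 1))]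
  · rw [Finset.sum_const, nsmul_eq_mul, Finset.card_univ, Fintype.card_fun, resCard,
      Nat.card_eq_fintype_card]
    push_cast
    rfl
  · intro y _
    rw [← measure_residueBall m y, Set.inter_eq_left.2]
    exact fun v hv => mem_closedBall_zero_iff.2 (norm_le_one_of_mem_residueBall hv)

lemma measure_ball_one_pos : 0 < m (Metric.ball 0 1) := Metric.measure_ball_pos m 0 one_pos

lemma measure_ball_one_ne_top : m (Metric.ball 0 1) ≠ ⊤ := measure_ball_lt_top.ne

/-- Homotheties as automorphisms. -/
def smulEquiv {c : k} (hc : c ≠ 0) : (ι → k) ≃ₜ+ (ι → k) where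
  toFun v := c • v
  invFun v := c⁻¹ • v
  left_inv v := by simp [hc]
  right_inv v := by simp [hc]
  map_add' v w := smul_add c v w
  continuous_toFun := by fun_prop
  continuous_invFun := by fun_prop

/-- The scaling factor is read off from the open unit ball: since norms are discrete, its preimage
is the closed unit ball, a union of q^|ι| residue classes. -/
lemma measure_smul_uniformizer_preimage {ϖ : k} (hk : IsNormalized k)
    (hϖ : ‖ϖ‖ = (resCard k : ℝ)⁻¹) (E : Set (ι → k)) :
    m {v | ϖ • v ∈ E} = (resCard k : ENNReal) ^ Fintype.card ι * m E := by
  have hq : (1 : ℝ) < resCard k := by exact_mod_cast one_lt_resCard k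
  have hϖ0 : ϖ ≠ 0 := norm_ne_zero_iff.1 (by rw [hϖ]; positivity)
  have h1 := fun X : Set (ι → k) => addEquivAddHaarChar_smul_preimage m (X := X)
    (smulEquiv (ι := ι) hϖ0)
  set κ := addEquivAddHaarChar (smulEquiv (ι := ι) hϖ0)
  have h2 : (smulEquiv (ι := ι) hϖ0) ⁻¹' Metric.ball 0 1 = Metric.closedBall 0 1 := by
    ext v
    have : (smulEquiv (ι := ι) hϖ0) v = ϖ • v := rfl
    rw [Set.mem_preimage, this, mem_ball_zero_iff, mem_closedBall_zero_iff, norm_smul, hϖ,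
      inv_mul_lt_iff₀ (by positivity), mul_one, pi_norm_lt_iff (by positivity),
      pi_norm_le_iff_of_nonneg zero_le_one]
    refine forall_congr' fun i => ⟨fun h => ?_, fun h => h.trans_lt hq⟩
    simpa using norm_le_zpow_of_lt hk (m := 1) (by simpa using h)
  have h3 := h1 (Metric.ball 0 1)
  rw [h2, measure_closedBall_one, ENNReal.smul_def, smul_eq_mul, ← mul_assoc] at h3
  have h4 : (κ : ENNReal) * (resCard k : ENNReal) ^ Fintype.card ι = 1 :=
    (ENNReal.mul_eq_right (measure_ball_one_pos m).ne' (measure_ball_one_ne_top m)).1 h3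
  have h5 := h1 E
  rw [← h5, ENNReal.smul_def, smul_eq_mul, ← mul_assoc, mul_comm (_ ^ _) (κ : ENNReal), h4, one_mul]
  rfl

lemma measure_smul_uniformizer_pow_preimage {ϖ : k} (hk : IsNormalized k)
    (hϖ : ‖ϖ‖ = (resCard k : ℝ)⁻¹) (E : Set (ι → k)) (j : ℕ) :
    m {v | ϖ ^ j • v ∈ E} = (resCard k : ENNReal) ^ (j * Fintype.card ι) * m E := by
  induction j with
  | zero => simp
  | succ j ih =>
    have h := measure_smul_uniformizer_preimage m hk hϖ {v | ϖ ^ j • v ∈ E}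
    simp only [Set.mem_ofPred_eq, smul_smul, ← pow_succ] at h
    rw [h, ih, ← mul_assoc, ← pow_add]
    congr 2
    ring

/-- In norm at most 1 the condition on the form depends only on the reduction, and a reduction of
length 1 is nonzero, which forces ‖v‖ = 1. -/
lemma measure_levelSet_zero [DecidableEq ι]
    [DecidableEq (IsLocalRing.ResidueField (IntRing k))] [Fintype (IsLocalRing.ResidueField (IntRing k))]
    (S : Matrix ι ι (IntRing k)) :
    m (levelSet S 0) = ((Finset.univ.filter
      (fun y : ι → IsLocalRing.ResidueField (IntRing k) => y ⬝ᵥ residueMatrix S *ᵥ y = 1)).card :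
        ENNReal) * m (Metric.ball 0 1) := by
  have hmem : ∀ y : ι → IsLocalRing.ResidueField (IntRing k), ∀ v ∈ residueBall y,
      (‖quadForm (integralMatrix S) v - 1‖ < 1 ↔ quadForm (residueMatrix S) y = 1) := by
    intro y v hv
    have := norm_quadForm_sub_lt_one_iff S hv 1
    simpa using this
  rw [measure_eq_sum_residueBall m (measurableSet_levelSet S 0) (Finset.univ.filter
      (fun y : ι → IsLocalRing.ResidueField (IntRing k) => y ⬝ᵥ residueMatrix S *ᵥ y = 1))]
  · rw [Finset.sum_congr rfl (g := fun _ => m (Metric.ball 0 1))]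
    · rw [Finset.sum_const, nsmul_eq_mul]
    · intro y hy
      rw [← measure_residueBall m y, Set.inter_eq_left.2]
      intro v hv
      have hy1 : quadForm (residueMatrix S) y = 1 := (Finset.mem_filter.1 hy).2
      refine ⟨?_, (hmem y v hv).2 hy1⟩
      rw [pow_zero]
      refine le_antisymm (norm_le_one_of_mem_residueBall hv) (not_lt.1 fun h => ?_)
      rw [norm_lt_one_iff_of_mem_residueBall hv] at h
      subst h
      simp [quadForm] at hy1
  · rintro v ⟨h1, h2⟩
    rw [pow_zero] at h1
    obtain ⟨y, hy⟩ := exists_mem_residueBall h1.le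
    exact ⟨y, Finset.mem_filter.2 ⟨Finset.mem_univ _, (hmem y v hy).1 h2⟩, hy⟩

/-- Multiplying by ϖ^j carries the shell to the unit vectors with |Q - ϖ^(2j)| < q^(-2j). Their
reductions are the nonzero isotropic vectors, where the nondegenerate reduced form is smooth, so
each residue class contributes a share q^(-2j) of its volume. -/
lemma pow_mul_measure_levelSet [DecidableEq ι]
    [DecidableEq (IsLocalRing.ResidueField (IntRing k))] [Fintype (IsLocalRing.ResidueField (IntRing k))]
    (hk : IsNormalized k) (h2 : IsUnit (2 : IntRing k))
    {S : Matrix ι ι (IntRing k)} (hS : S.IsSymm) (hdet : IsUnit S.det) {j : ℕ} (hj : 0 < j) :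
    (resCard k : ENNReal) ^ (2 * j) * m (levelSet S j) =
      (resCard k : ENNReal) ^ (j * Fintype.card ι) * (((Finset.univ.filter
      (fun y : ι → IsLocalRing.ResidueField (IntRing k) =>
        y ⬝ᵥ residueMatrix S *ᵥ y = 0 ∧ y ≠ 0)).card : ENNReal) * m (Metric.ball 0 1)) := by
  have hq : (1 : ℝ) < resCard k := by exact_mod_cast one_lt_resCard k
  obtain ⟨ϖ, hϖ, -⟩ := exists_uniformizer hk
  have hϖ0 : ϖ ≠ 0 := norm_ne_zero_iff.1 (by rw [hϖ]; positivity)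
  have hϖ1 : ‖ϖ‖ ≤ 1 := by rw [hϖ]; exact inv_le_one_of_one_le₀ hq.le
  let c : IntRing k := ⟨ϖ ^ (2 * j), mem_intRing_iff.2 (by
    rw [norm_pow]; exact pow_le_one₀ (norm_nonneg _) hϖ1)⟩
  have hc : (c : k) = ϖ ^ (2 * j) := rfl
  have hc0 : IsLocalRing.residue (IntRing k) c = 0 := by
    rw [residue_eq_zero_iff_norm_lt, hc, norm_pow, hϖ]
    exact pow_lt_one₀ (by positivity) (inv_lt_one_of_one_lt₀ hq) (by omega)
  set E : Set (ι → k) := {v | ‖v‖ = 1 ∧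
    ‖quadForm (integralMatrix S) v - c‖ < ((resCard k : ℝ)⁻¹) ^ (2 * j)} with hE
  have hEm : MeasurableSet E := by
    have := continuous_quadForm (integralMatrix S)
    refine MeasurableSet.inter (s₁ := {v | ‖v‖ = 1})
      (s₂ := {v | ‖quadForm (integralMatrix S) v - c‖ < ((resCard k : ℝ)⁻¹) ^ (2 * j)})
      (isClosed_eq continuous_norm continuous_const).measurableSet
      (isOpen_lt ?_ continuous_const).measurableSet
    fun_prop
  have hlev : levelSet S j = {v | ϖ ^ j • v ∈ E} := by
    ext v
    simp only [levelSet, hE, Set.mem_ofPred_eq, norm_smul, norm_pow, hϖ, quadForm_smul, hc]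
    have h3 : (ϖ ^ j) ^ 2 * quadForm (integralMatrix S) v - ϖ ^ (2 * j) =
        ϖ ^ (2 * j) * (quadForm (integralMatrix S) v - 1) := by ring
    have hpos : (0 : ℝ) < ((resCard k : ℝ)⁻¹) ^ (2 * j) := by positivity
    rw [h3, norm_mul, norm_pow, hϖ, mul_lt_iff_lt_one_right hpos, inv_pow,
      inv_mul_eq_one₀ (by positivity), eq_comm]
  rw [hlev, measure_smul_uniformizer_pow_preimage m hk hϖ, mul_left_comm]
  congr 1
  have hmem : ∀ y : ι → IsLocalRing.ResidueField (IntRing k), ∀ v ∈ residueBall y,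
      (‖quadForm (integralMatrix S) v - c‖ < 1 ↔ quadForm (residueMatrix S) y = 0) := by
    intro y v hv
    rw [norm_quadForm_sub_lt_one_iff S hv c, hc0]
  rw [measure_eq_sum_residueBall m hEm (Finset.univ.filter
      (fun y : ι → IsLocalRing.ResidueField (IntRing k) =>
        y ⬝ᵥ residueMatrix S *ᵥ y = 0 ∧ y ≠ 0)), Finset.mul_sum]
  · rw [Finset.sum_congr rfl (g := fun _ => m (Metric.ball 0 1))]
    · rw [Finset.sum_const, nsmul_eq_mul]
    · intro y hy
      obtain ⟨-, hy0, hy1⟩ := Finset.mem_filter.1 hy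
      have hrdet : (residueMatrix S).det ≠ 0 := by
        have := (hdet.map (IsLocalRing.residue (IntRing k))).ne_zero
        rwa [RingHom.map_det] at this
      obtain ⟨i, hi⟩ : ∃ i, (residueMatrix S *ᵥ y) i ≠ 0 := by
        by_contra! h
        exact hy1 (Matrix.eq_zero_of_mulVec_eq_zero hrdet (funext h))
      rw [← pow_mul_measure_residueBall_inter m hk hS h2 hi c (by rw [hc0]; exact hy0) (2 * j)]
      congr 2
      ext v
      simp only [hE, Set.mem_inter_iff, Set.mem_ofPred_eq]
      refine and_congr_right fun hv => and_iff_right ?_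
      refine le_antisymm (norm_le_one_of_mem_residueBall hv) (not_lt.1 fun h => ?_)
      exact hy1 ((norm_lt_one_iff_of_mem_residueBall hv).1 h)
  · rintro v ⟨h1, h3⟩
    obtain ⟨y, hy⟩ := exists_mem_residueBall h1.le
    refine ⟨y, Finset.mem_filter.2 ⟨Finset.mem_univ _, (hmem y v hy).1 (h3.trans_le ?_), ?_⟩, hy⟩
    · exact pow_le_one₀ (by positivity) (inv_le_one_of_one_le₀ hq.le)
    · rintro rfl
      exact ((norm_lt_one_iff_of_mem_residueBall hy).2 rfl).ne h1

variable [DecidableEq ι]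

/-- The volumes of the level sets of a unimodular form in an odd number of variables. -/
theorem measureReal_levelSet (hk : IsNormalized k) (h2 : IsUnit (2 : IntRing k))
    {S : Matrix ι ι (IntRing k)} (hS : S.IsSymm) (hdet : IsUnit S.det) {r : ℕ}
    (hι : Fintype.card ι = 2 * r + 1) :
    (m.real (levelSet S 0) : ℂ) = ((resCard k : ℂ) ^ (2 * r) +
        quadChar ((-1) ^ r * S.det) * (resCard k : ℂ) ^ r) * m.real (Metric.ball 0 1) ∧
      ∀ j : ℕ, (m.real (levelSet S (j + 1)) : ℂ) * (resCard k : ℂ) ^ (2 * (j + 1)) =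
        (resCard k : ℂ) ^ ((j + 1) * Fintype.card ι) *
          (((resCard k : ℂ) ^ (2 * r) - 1) * m.real (Metric.ball 0 1)) := by
  classical
  have : Finite (IsLocalRing.ResidueField (IntRing k)) := finite_residueField
  have := Fintype.ofFinite (IsLocalRing.ResidueField (IntRing k))
  have hrS : (residueMatrix S).IsSymm := by
    ext a b
    have := congrFun (congrFun hS.eq a) b
    simp only [transpose_apply] at this
    simp [residueMatrix, this]
  have hrd : (residueMatrix S).det = IsLocalRing.residue (IntRing k) S.det :=
    (RingHom.map_det _ _).symm
  have hrdet : (residueMatrix S).det ≠ 0 := by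
    rw [hrd]
    exact (hdet.map (IsLocalRing.residue (IntRing k))).ne_zero
  have hcount := card_quadratic_eq (residue_two_ne_zero h2) hι (residueMatrix S) hrS hrdet
  have hqc : (Fintype.card (IsLocalRing.ResidueField (IntRing k)) : ℂ) = resCard k := by
    rw [resCard, Nat.card_eq_fintype_card]
  rw [hqc] at hcount
  constructor
  · have h := congrArg ENNReal.toReal (measure_levelSet_zero m S)
    rw [ENNReal.toReal_mul, ENNReal.toReal_natCast] at h
    rw [Measure.real, h]
    push_cast
    rw [hcount 1, mul_one, hrd]
    have hu : IsUnit ((-1 : IntRing k) ^ r * S.det) := (isUnit_one.neg.pow r).mul hdet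
    rw [← quadraticChar_residue_eq_quadChar h2 hu]
    simp [Measure.real]
  · intro j
    have h := congrArg ENNReal.toReal (pow_mul_measure_levelSet m hk h2 hS hdet (j := j + 1)
      (Nat.succ_pos j))
    simp only [ENNReal.toReal_mul, ENNReal.toReal_natCast, ENNReal.toReal_pow] at h
    -- For c = 0 the character term of the count vanishes; the zero vector is then removed.
    have hcard : ((Finset.univ.filter (fun y : ι → IsLocalRing.ResidueField (IntRing k) =>
        y ⬝ᵥ residueMatrix S *ᵥ y = 0 ∧ y ≠ 0)).card : ℂ) = (resCard k : ℂ) ^ (2 * r) - 1 := by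
      have h0 := hcount 0
      rw [mul_zero, MulChar.map_zero, Int.cast_zero, zero_mul, add_zero] at h0
      rw [← h0, ← Finset.filter_filter, Finset.filter_ne', Finset.card_erase_of_mem,
        Nat.cast_sub, Nat.cast_one]
      · exact Finset.card_pos.2 ⟨0, by simp⟩
      · simp
    have h' := congrArg (fun x : ℝ => (x : ℂ)) h
    push_cast at h'
    rw [hcard] at h'
    rw [mul_comm]
    exact h'

end LevelSets

/-! ### Orthogonal transformations preserve Haar measure. -/

section MatrixHaar

variable {k : Type*} [NontriviallyNormedField k] [ProperSpace k] {ι : Type*} [Fintype ι]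
  [DecidableEq ι] [MeasurableSpace k] [BorelSpace k]

/-- The automorphism `v ↦ v g` of the space of row vectors. -/
def vecMulEquiv {k : Type*} [NontriviallyNormedField k] {ι : Type*} [Fintype ι]
    [DecidableEq ι] (g : GL ι k) : (ι → k) ≃ₜ+ (ι → k) where
  toFun v := v ᵥ* (g : Matrix ι ι k)
  invFun v := v ᵥ* ((g⁻¹ : GL ι k) : Matrix ι ι k)
  left_inv v := by simp [vecMul_vecMul]
  right_inv v := by simp [vecMul_vecMul]
  map_add' v w := add_vecMul _ v w
  continuous_toFun := by fun_prop
  continuous_invFun := by fun_prop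

/-- The factor by which `v ↦ v g` scales Haar measures. -/
noncomputable def vecMulChar (g : GL ι k) : NNReal := addEquivAddHaarChar (vecMulEquiv g)

lemma vecMulChar_mul (g h : GL ι k) : vecMulChar (g * h) = vecMulChar g * vecMulChar h := by
  rw [vecMulChar, vecMulChar, vecMulChar, ← addEquivAddHaarChar_trans]
  congr 1
  ext v : 1
  change v ᵥ* ((g * h : GL ι k) : Matrix ι ι k) = (v ᵥ* (g : Matrix ι ι k)) ᵥ* (h : Matrix ι ι k)
  rw [vecMul_vecMul, Units.val_mul]

lemma vecMulChar_pos (g : GL ι k) : 0 < vecMulChar g := addEquivAddHaarChar_pos _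

lemma vecMulChar_one : vecMulChar (1 : GL ι k) = 1 := by
  have h := vecMulChar_mul (1 : GL ι k) 1
  rw [mul_one] at h
  exact (mul_eq_left₀ (vecMulChar_pos _).ne').1 h.symm

lemma vecMulChar_eq_one_of_sq {g : GL ι k} (h : vecMulChar g * vecMulChar g = 1) :
    vecMulChar g = 1 := by
  rw [← sq] at h
  exact (pow_eq_one_iff_of_nonneg (zero_le) two_ne_zero).1 h

/-- A diagonal sign change conjugates the transvection to its inverse. The scaling factor is
multiplicative with commuting values, so its square is 1, and it is positive. -/
lemma vecMulChar_transvection {i j : ι} (hij : i ≠ j) (c : k) (g : GL ι k)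
    (hg : (g : Matrix ι ι k) = transvection i j c) : vecMulChar g = 1 := by
  let d : GL ι k := GeneralLinearGroup.mkOfDetNeZero
    (diagonal (fun l => if l = i then (-1 : k) else 1)) (by
      rw [det_diagonal, Finset.prod_ne_zero_iff]
      intro l _
      split_ifs <;> simp)
  have hd : (d : Matrix ι ι k) = diagonal (fun l => if l = i then (-1 : k) else 1) := rfl
  have hconj : g * (d * (g * d)) = 1 := by
    ext1
    simp only [Units.val_mul, hg, hd, Units.val_one]
    have h1 : diagonal (fun l => if l = i then (-1 : k) else 1) *
        (transvection i j c * diagonal (fun l => if l = i then (-1 : k) else 1)) =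
        transvection i j (-c) := by
      ext a b
      rw [diagonal_mul, mul_diagonal]
      simp only [transvection, Matrix.add_apply, one_apply, single_apply]
      grind
    rw [h1, transvection_mul_transvection_same _ _ hij]
    simp
  have hdd : d * d = 1 := by
    ext1
    simp only [Units.val_mul, hd, Units.val_one, diagonal_mul_diagonal, ← diagonal_one]
    congr 1
    ext l
    split_ifs <;> simp
  have h1 := congrArg vecMulChar hconj
  have h2 := congrArg vecMulChar hdd
  simp only [vecMulChar_mul, vecMulChar_one] at h1 h2
  apply vecMulChar_eq_one_of_sq
  calc vecMulChar g * vecMulChar g = vecMulChar g * (vecMulChar g * (vecMulChar d * vecMulChar d)) := by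
        rw [h2, mul_one]
    _ = 1 := by rw [← h1]; ring

/-- Diagonal matrices and transvections generate. Transposition fixes the former and sends
transvections to transvections, of factor 1; the reversed order of products is harmless because the
factors commute. -/
lemma vecMulChar_transpose (g g' : GL ι k) (h : (g' : Matrix ι ι k) = (g : Matrix ι ι k)ᵀ) :
    vecMulChar g' = vecMulChar g := by
  have key : ∀ M : Matrix ι ι k, M.det ≠ 0 → ∀ g g' : GL ι k, (g : Matrix ι ι k) = M →
      (g' : Matrix ι ι k) = Mᵀ → vecMulChar g' = vecMulChar g := by
    intro M hM
    refine diagonal_transvection_induction_of_det_ne_zero (fun M => ∀ g g' : GL ι k,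
      (g : Matrix ι ι k) = M → (g' : Matrix ι ι k) = Mᵀ → vecMulChar g' = vecMulChar g) M hM ?_ ?_ ?_
    · intro D _ g g' hg hg'
      have : g' = g := by ext1; rw [hg, hg', diagonal_transpose]
      rw [this]
    · intro t g g' hg hg'
      rw [vecMulChar_transvection t.hij t.c g hg,
        vecMulChar_transvection t.hij.symm t.c g' (by
          rw [hg']
          simp [TransvectionStruct.toMatrix, transvection, transpose_single])]
    · intro A B hA hB ihA ihB g g' hg hg'
      let a : GL ι k := GeneralLinearGroup.mkOfDetNeZero A hA
      let b : GL ι k := GeneralLinearGroup.mkOfDetNeZero B hB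
      let a' : GL ι k := GeneralLinearGroup.mkOfDetNeZero Aᵀ (by rwa [det_transpose])
      let b' : GL ι k := GeneralLinearGroup.mkOfDetNeZero Bᵀ (by rwa [det_transpose])
      have h1 : g = a * b := by ext1; rw [hg, Units.val_mul]; rfl
      have h2 : g' = b' * a' := by ext1; rw [hg', Units.val_mul, transpose_mul]; rfl
      rw [h1, h2, vecMulChar_mul, vecMulChar_mul, ihA a a' rfl rfl, ihB b b' rfl rfl, mul_comm]
  exact key g (by
    have := (Matrix.isUnit_iff_isUnit_det _).1 g.isUnit
    exact this.ne_zero) g g' rfl h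

/-- Taking scaling factors in g S gᵀ = S and cancelling that of S leaves the square of the factor of
g equal to 1. -/
lemma vecMulChar_of_orthogonal {S : Matrix ι ι k} (hS : S.det ≠ 0) {g : GL ι k}
    (hg : (g : Matrix ι ι k) * S * (g : Matrix ι ι k)ᵀ = S) : vecMulChar g = 1 := by
  have hgd : (g : Matrix ι ι k).det ≠ 0 := ((Matrix.isUnit_iff_isUnit_det _).1 g.isUnit).ne_zero
  let s : GL ι k := GeneralLinearGroup.mkOfDetNeZero S hS
  let g' : GL ι k := GeneralLinearGroup.mkOfDetNeZero (g : Matrix ι ι k)ᵀ (by rwa [det_transpose])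
  have h1 : g * s * g' = s := Units.ext hg
  have h2 := congrArg vecMulChar h1
  rw [vecMulChar_mul, vecMulChar_mul, vecMulChar_transpose g g' rfl] at h2
  apply vecMulChar_eq_one_of_sq
  exact (mul_eq_right₀ (vecMulChar_pos s).ne').1 ((mul_right_comm _ _ _).trans h2)

/-- Orthogonal transformations preserve Haar measures. -/
theorem measurePreserving_vecMul_of_orthogonal (m : Measure (ι → k)) [m.IsAddHaarMeasure]
    {S : Matrix ι ι k} (hS : S.det ≠ 0) {g : GL ι k}
    (hg : (g : Matrix ι ι k) * S * (g : Matrix ι ι k)ᵀ = S) :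
    MeasurePreserving (fun v => v ᵥ* (g : Matrix ι ι k)) m m := by
  refine ⟨(by fun_prop : Continuous fun v => v ᵥ* (g : Matrix ι ι k)).measurable, ?_⟩
  have := addEquivAddHaarChar_smul_map m (vecMulEquiv g)
  rw [show addEquivAddHaarChar (vecMulEquiv g) = 1 from vecMulChar_of_orthogonal hS hg,
    one_smul] at this
  exact this

end MatrixHaar

/-! ### Reflections and Witt's theorem for vectors. -/

section Reflections

variable {K : Type*} [Field K] {ι : Type*} [Fintype ι] [DecidableEq ι]

lemma ext_of_vecMul {A B : Matrix ι ι K} (h : ∀ v, v ᵥ* A = v ᵥ* B) : A = B := by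
  ext i j
  have := congrFun (h (Pi.single i 1)) j
  simpa using this

lemma vecMul_dotProduct_mulVec_vecMul {ι : Type*} [Fintype ι] (M S : Matrix ι ι K) (v u : ι → K) :
    (v ᵥ* M) ⬝ᵥ S *ᵥ (u ᵥ* M) = v ⬝ᵥ (M * S * Mᵀ) *ᵥ u := by
  rw [← mulVec_transpose M u, ← mulVec_mulVec, ← mulVec_mulVec, dotProduct_mulVec v M]

lemma dotProduct_mulVec_vecMul_of_mem_orthGroup {S : Matrix ι ι K} {g : GL ι K}
    (hg : g ∈ orthGroup S) (v u : ι → K) :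
    (v ᵥ* (g : Matrix ι ι K)) ⬝ᵥ S *ᵥ (u ᵥ* (g : Matrix ι ι K)) = v ⬝ᵥ S *ᵥ u := by
  have hg' : (g : Matrix ι ι K) * S * (g : Matrix ι ι K)ᵀ = S := hg
  rw [vecMul_dotProduct_mulVec_vecMul, hg']

/-- The matrix of the reflection in `w`. -/
def reflectionMatrix (S : Matrix ι ι K) (w : ι → K) : Matrix ι ι K :=
  1 - (2 / quadForm S w) • vecMulVec (S *ᵥ w) w

lemma vecMul_reflectionMatrix (S : Matrix ι ι K) (w v : ι → K) :
    v ᵥ* reflectionMatrix S w = v - (2 / quadForm S w * (v ⬝ᵥ S *ᵥ w)) • w := by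
  rw [reflectionMatrix, vecMul_sub, vecMul_one, vecMul_smul, vecMul_vecMulVec, smul_smul]

lemma reflectionMatrix_mul_self {S : Matrix ι ι K} {w : ι → K} (hw : quadForm S w ≠ 0) :
    reflectionMatrix S w * reflectionMatrix S w = 1 := by
  refine ext_of_vecMul fun v => ?_
  rw [← vecMul_vecMul, vecMul_reflectionMatrix, vecMul_reflectionMatrix, vecMul_one,
    sub_dotProduct, smul_dotProduct, sub_sub, ← add_smul]
  have h : w ⬝ᵥ S *ᵥ w = quadForm S w := rfl
  rw [h, smul_eq_mul]
  have : 2 / quadForm S w * (v ⬝ᵥ S *ᵥ w) + 2 / quadForm S w *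
      (v ⬝ᵥ S *ᵥ w - 2 / quadForm S w * (v ⬝ᵥ S *ᵥ w) * quadForm S w) = 0 := by
    field_simp
    ring
  rw [this, zero_smul, sub_zero]

/-- The reflection in `w`. -/
def reflection (S : Matrix ι ι K) {w : ι → K} (hw : quadForm S w ≠ 0) : GL ι K :=
  ⟨reflectionMatrix S w, reflectionMatrix S w, reflectionMatrix_mul_self hw,
    reflectionMatrix_mul_self hw⟩

lemma reflection_mem_orthGroup {S : Matrix ι ι K} (hS : S.IsSymm) {w : ι → K}
    (hw : quadForm S w ≠ 0) : reflection S hw ∈ orthGroup S := by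
  change reflectionMatrix S w * S * (reflectionMatrix S w)ᵀ = S
  have key : ∀ v u : ι → K,
      v ⬝ᵥ (reflectionMatrix S w * S * (reflectionMatrix S w)ᵀ) *ᵥ u = v ⬝ᵥ S *ᵥ u := by
    intro v u
    rw [← vecMul_dotProduct_mulVec_vecMul, vecMul_reflectionMatrix, vecMul_reflectionMatrix]
    simp only [sub_dotProduct, smul_dotProduct, mulVec_sub, mulVec_smul, dotProduct_sub,
      dotProduct_smul, smul_eq_mul]
    have h : w ⬝ᵥ S *ᵥ w = quadForm S w := rfl
    rw [h, dotProduct_mulVec_comm_of_isSymm hS w u]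
    field_simp
    ring
  ext i j
  have := key (Pi.single i 1) (Pi.single j 1)
  simpa using this

/-- Two vectors on which the form takes the same nonzero value are related by an isometry which
fixes every vector orthogonal to both of them. -/
lemma exists_orthGroup_vecMul_eq {S : Matrix ι ι K} (hS : S.IsSymm) (h2 : (2 : K) ≠ 0)
    {x y : ι → K} (hxy : quadForm S x = quadForm S y) (hy : quadForm S y ≠ 0) :
    ∃ g ∈ orthGroup S, x ᵥ* (g : Matrix ι ι K) = y ∧
      ∀ v, v ⬝ᵥ S *ᵥ x = 0 → v ⬝ᵥ S *ᵥ y = 0 → v ᵥ* (g : Matrix ι ι K) = v := by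
  have hyx := dotProduct_mulVec_comm_of_isSymm hS y x
  have hx' : x ⬝ᵥ S *ᵥ x = quadForm S y := hxy
  have hy' : y ⬝ᵥ S *ᵥ y = quadForm S y := rfl
  have hm : quadForm S (x - y) = 2 * (x ⬝ᵥ S *ᵥ (x - y)) := by
    simp only [quadForm, sub_dotProduct, mulVec_sub, dotProduct_sub]
    rw [hyx, hx', hy']
    ring
  -- Since Q(x - y) + Q(x + y) = 4Q(y) ≠ 0, at least one of x - y and x + y is anisotropic.
  by_cases h : quadForm S (x - y) = 0
  · have hp : quadForm S (x + y) = 2 * (x ⬝ᵥ S *ᵥ (x + y)) := by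
      simp only [quadForm, add_dotProduct, mulVec_add, dotProduct_add]
      rw [hyx, hx', hy']
      ring
    have hp0 : quadForm S (x + y) ≠ 0 := by
      have : quadForm S (x + y) = 2 * (2 * quadForm S y) := by
        rw [h] at hm
        rw [hp, mulVec_add, dotProduct_add, hx']
        rw [mulVec_sub, dotProduct_sub, hx'] at hm
        linear_combination hm
      rw [this]
      exact mul_ne_zero h2 (mul_ne_zero h2 hy)
    -- The reflection in x + y sends x to -y, and the reflection in y sends -y to y.
    refine ⟨reflection S hp0 * reflection S hy, mul_mem (reflection_mem_orthGroup hS _)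
      (reflection_mem_orthGroup hS _), ?_, fun v hvx hvy => ?_⟩
    · rw [Units.val_mul, ← vecMul_vecMul]
      change (x ᵥ* reflectionMatrix S (x + y)) ᵥ* reflectionMatrix S y = y
      have h1 : 2 / quadForm S (x + y) * (x ⬝ᵥ S *ᵥ (x + y)) = 1 := by
        rw [div_mul_eq_mul_div, ← hp, div_self hp0]
      rw [vecMul_reflectionMatrix S (x + y), h1, one_smul, sub_add_cancel_left, vecMul_reflectionMatrix,
        neg_dotProduct, hy', mul_neg, div_mul_cancel₀ _ hy, neg_smul, two_smul]
      abel
    · rw [Units.val_mul, ← vecMul_vecMul]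
      change (v ᵥ* reflectionMatrix S (x + y)) ᵥ* reflectionMatrix S y = v
      rw [vecMul_reflectionMatrix S (x + y), mulVec_add, dotProduct_add, hvx, hvy]
      simp [vecMul_reflectionMatrix, hvy]
  · refine ⟨reflection S h, reflection_mem_orthGroup hS _, ?_, fun v hvx hvy => ?_⟩
    · change x ᵥ* reflectionMatrix S (x - y) = y
      have h1 : 2 / quadForm S (x - y) * (x ⬝ᵥ S *ᵥ (x - y)) = 1 := by
        rw [div_mul_eq_mul_div, ← hm, div_self h]
      rw [vecMul_reflectionMatrix, h1, one_smul, sub_sub_cancel]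
    · change v ᵥ* reflectionMatrix S (x - y) = v
      rw [vecMul_reflectionMatrix, mulVec_sub, dotProduct_sub, hvx, hvy]
      simp

end Reflections

/-! ### The quotient Θ\H as the quadric of vectors of length one. -/

section Structure

variable {k : Type*} [NontriviallyNormedField k] [IsUltrametricDist k] {n : ℕ}

/-- Coordinates of `k^(n+2) = k e₊ ⊕ k^(n+1)`. -/
abbrev SubIdx (n : ℕ) : Type := Unit ⊕ Fin (n + 1)

/-- The inclusion of the coordinates of `k^(n+2)` into those of `k^(n+3)`. -/
def inclIdx (n : ℕ) : SubIdx n → Idx n := Sum.map id Sum.inl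

/-- Extension of a vector of `k^(n+2)` by zero. -/
def extend (x : SubIdx n → k) : Idx n → k :=
  Sum.elim (fun a => x (Sum.inl a)) (Sum.elim (fun b => x (Sum.inr b)) 0)

/-- The Gram matrix `diag(1, A)` of the form on `k^(n+2)`. -/
noncomputable def subGram (A : Matrix (Fin (n + 1)) (Fin (n + 1)) (IntRing k)) :
    Matrix (SubIdx n) (SubIdx n) (IntRing k) :=
  fromBlocks 1 0 0 A

lemma det_subGram (A : Matrix (Fin (n + 1)) (Fin (n + 1)) (IntRing k)) :
    (subGram A).det = A.det := by
  simp [subGram]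

lemma isSymm_subGram {A : Matrix (Fin (n + 1)) (Fin (n + 1)) (IntRing k)} (hA : A.IsSymm) :
    (subGram A).IsSymm :=
  IsSymm.fromBlocks isSymm_one (by simp) hA

lemma isSymm_gram {A : Matrix (Fin (n + 1)) (Fin (n + 1)) (IntRing k)} (hA : A.IsSymm) :
    (gram A).IsSymm :=
  IsSymm.fromBlocks isSymm_one (by simp)
    (IsSymm.fromBlocks (hA.map _) (by simp) (isSymm_one.neg))

lemma det_integralMatrix {ι : Type*} [Fintype ι] [DecidableEq ι] (S : Matrix ι ι (IntRing k)) :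
    (integralMatrix S).det = (S.det : k) :=
  (RingHom.map_det (IntRing k).subtype S).symm

lemma det_integralMatrix_ne_zero {ι : Type*} [Fintype ι] [DecidableEq ι]
    {S : Matrix ι ι (IntRing k)} (hS : IsUnit S.det) : (integralMatrix S).det ≠ 0 := by
  rw [det_integralMatrix]
  simpa using hS.ne_zero

lemma extend_dotProduct_gram_mulVec_extend (A : Matrix (Fin (n + 1)) (Fin (n + 1)) (IntRing k))
    (x y : SubIdx n → k) :
    extend x ⬝ᵥ gram A *ᵥ extend y = x ⬝ᵥ integralMatrix (subGram A) *ᵥ y := by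
  simp [extend, gram, dotProduct, mulVec, Fintype.sum_sum_type, integralMatrix, subGram]

lemma dotProduct_gram_mulVec_eMinus (A : Matrix (Fin (n + 1)) (Fin (n + 1)) (IntRing k))
    (v : Idx n → k) : v ⬝ᵥ gram A *ᵥ eMinus k n = - v (Sum.inr (Sum.inr ())) := by
  simp [gram, eMinus, dotProduct, Fintype.sum_sum_type]

lemma extend_eq_of_last_eq_zero {k : Type*} [NontriviallyNormedField k] {n : ℕ} {v : Idx n → k} (hv : v (Sum.inr (Sum.inr ())) = 0) :
    extend (v ∘ inclIdx n) = v := by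
  ext i
  rcases i with i | i | i
  · rfl
  · rfl
  · exact hv.symm

lemma extend_comp_inclIdx {k : Type*} [NontriviallyNormedField k] {n : ℕ} (x : SubIdx n → k) : extend x ∘ inclIdx n = x := by
  ext i
  rcases i with i | i <;> rfl

variable {A : Matrix (Fin (n + 1)) (Fin (n + 1)) (IntRing k)}

/-- The matrix of the restriction of `h` to `k^(n+2)`. -/
def blockMatrix (h : H A) : Matrix (SubIdx n) (SubIdx n) k :=
  ((h : GL (Idx n) k) : Matrix (Idx n) (Idx n) k).submatrix (inclIdx n) (inclIdx n)

/-- The last coordinate is -⟨v, e₋⟩, and h is an isometry fixing e₋. In particular h preserves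
k^(n+2) and acts there through `blockMatrix`. -/
lemma vecMul_last_eq (h : H A) (v : Idx n → k) :
    (v ᵥ* ((h : GL (Idx n) k) : Matrix (Idx n) (Idx n) k)) (Sum.inr (Sum.inr ())) =
      v (Sum.inr (Sum.inr ())) := by
  have h1 := dotProduct_mulVec_vecMul_of_mem_orthGroup h.2.1 v (eMinus k n)
  have h2 : eMinus k n ᵥ* ((h : GL (Idx n) k) : Matrix (Idx n) (Idx n) k) = eMinus k n := h.2.2
  rw [h2, dotProduct_gram_mulVec_eMinus, dotProduct_gram_mulVec_eMinus] at h1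
  exact neg_injective h1

lemma extend_vecMul (h : H A) (x : SubIdx n → k) :
    extend x ᵥ* ((h : GL (Idx n) k) : Matrix (Idx n) (Idx n) k) = extend (x ᵥ* blockMatrix h) := by
  rw [← extend_eq_of_last_eq_zero ((vecMul_last_eq h (extend x)).trans rfl)]
  congr 1
  ext j
  simp [vecMul, dotProduct, Fintype.sum_sum_type, extend, blockMatrix, inclIdx]

lemma extend_injective {k : Type*} [NontriviallyNormedField k] {n : ℕ} : Function.Injective (extend : (SubIdx n → k) → Idx n → k) := by
  intro x y h
  rw [← extend_comp_inclIdx x, h, extend_comp_inclIdx]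

lemma vecMul_blockMatrix_mul (x : SubIdx n → k) (g h : H A) :
    (x ᵥ* blockMatrix g) ᵥ* blockMatrix h = x ᵥ* blockMatrix (g * h) := by
  apply extend_injective
  rw [← extend_vecMul, ← extend_vecMul, ← extend_vecMul, vecMul_vecMul]
  rfl

lemma vecMul_blockMatrix_one (x : SubIdx n → k) : x ᵥ* blockMatrix (1 : H A) = x := by
  apply extend_injective
  rw [← extend_vecMul]
  simp

lemma blockMatrix_orthogonal (h : H A) :
    blockMatrix h * integralMatrix (subGram A) * (blockMatrix h)ᵀ = integralMatrix (subGram A) := by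
  have key : ∀ x y : SubIdx n → k,
      x ⬝ᵥ (blockMatrix h * integralMatrix (subGram A) * (blockMatrix h)ᵀ) *ᵥ y =
        x ⬝ᵥ integralMatrix (subGram A) *ᵥ y := by
    intro x y
    rw [← vecMul_dotProduct_mulVec_vecMul, ← extend_dotProduct_gram_mulVec_extend,
      ← extend_vecMul, ← extend_vecMul, dotProduct_mulVec_vecMul_of_mem_orthGroup h.2.1,
      extend_dotProduct_gram_mulVec_extend]
  ext i j
  have := key (Pi.single i 1) (Pi.single j 1)
  simpa using this

lemma quadForm_vecMul_blockMatrix (h : H A) (x : SubIdx n → k) :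
    quadForm (integralMatrix (subGram A)) (x ᵥ* blockMatrix h) =
      quadForm (integralMatrix (subGram A)) x := by
  rw [quadForm, vecMul_dotProduct_mulVec_vecMul, blockMatrix_orthogonal]
  rfl

/-- The vector `e₊` of `k^(n+2)`. -/
def basePoint (k : Type*) [Field k] (n : ℕ) : SubIdx n → k := Pi.single (Sum.inl ()) 1

lemma extend_basePoint {k : Type*} [NontriviallyNormedField k] {n : ℕ} : extend (basePoint k n) = ePlus k n := by
  ext i
  rcases i with i | i | i <;> simp [extend, basePoint, ePlus]

lemma quadForm_basePoint : quadForm (integralMatrix (subGram A)) (basePoint k n) = 1 := by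
  simp [quadForm, basePoint, integralMatrix, subGram]

/-- `H` acts transitively on the vectors of length one. -/
lemma exists_basePoint_vecMul_eq (h2 : (2 : k) ≠ 0) (hA : A.IsSymm) {y : SubIdx n → k}
    (hy : quadForm (integralMatrix (subGram A)) y = 1) :
    ∃ h : H A, basePoint k n ᵥ* blockMatrix h = y := by
  have h1 : ∀ x : SubIdx n → k,
      quadForm (gram A) (extend x) = quadForm (integralMatrix (subGram A)) x :=
    fun x => extend_dotProduct_gram_mulVec_extend A x x
  have horth : ∀ x : SubIdx n → k, eMinus k n ⬝ᵥ gram A *ᵥ extend x = 0 := by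
    intro x
    rw [dotProduct_mulVec_comm_of_isSymm (isSymm_gram hA), dotProduct_gram_mulVec_eMinus]
    simp [extend]
  -- The isometry is built in k^(n+3); as e₋ is orthogonal to both vectors, it is fixed, so the
  -- isometry lies in H.
  obtain ⟨g, hg, hgx, hgv⟩ := exists_orthGroup_vecMul_eq (isSymm_gram hA) h2
    (x := extend (basePoint k n)) (y := extend y)
    (by rw [h1, h1, hy, quadForm_basePoint]) (by rw [h1, hy]; exact one_ne_zero)
  refine ⟨⟨g, hg, hgv _ (horth _) (horth _)⟩, ?_⟩
  apply extend_injective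
  rw [← extend_vecMul]
  exact hgx

/-- The orbit map `Θ h ↦ e₊ h`. -/
noncomputable def orbitMap (A : Matrix (Fin (n + 1)) (Fin (n + 1)) (IntRing k)) : ThetaH A → SubIdx n → k :=
  Quotient.lift (fun h : H A => basePoint k n ᵥ* blockMatrix h) (by
    intro a b hab
    rw [← Quotient.eq_iff_equiv, Quotient.eq, QuotientGroup.rightRel_apply] at hab
    have hfix : ePlus k n ᵥ* ((b * a⁻¹ : H A) : GL (Idx n) k).val = ePlus k n := hab
    apply extend_injective
    have hb : b = (b * a⁻¹) * a := by group
    simp only [← extend_vecMul]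
    rw [extend_basePoint]
    conv_rhs => rw [hb, Subgroup.coe_mul, Units.val_mul, ← vecMul_vecMul, hfix])

lemma orbitMap_injective : Function.Injective (orbitMap A) := by
  rintro ⟨a⟩ ⟨b⟩ hab
  have hab' : basePoint k n ᵥ* blockMatrix a = basePoint k n ᵥ* blockMatrix b := hab
  refine Quotient.sound ?_
  rw [← Quotient.eq_iff_equiv, Quotient.eq, QuotientGroup.rightRel_apply]
  change ePlus k n ᵥ* ((b * a⁻¹ : H A) : GL (Idx n) k).val = ePlus k n
  rw [← extend_basePoint, extend_vecMul, ← vecMul_blockMatrix_mul, ← hab', vecMul_blockMatrix_mul,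
    mul_inv_cancel, vecMul_blockMatrix_one]

lemma orbitMap_translate (h : H A) (z : ThetaH A) :
    orbitMap A (translate A h z) = orbitMap A z ᵥ* blockMatrix h := by
  obtain ⟨a⟩ := z
  exact (vecMul_blockMatrix_mul _ a h).symm

lemma quadForm_orbitMap (z : ThetaH A) :
    quadForm (integralMatrix (subGram A)) (orbitMap A z) = 1 := by
  obtain ⟨a⟩ := z
  exact (quadForm_vecMul_blockMatrix a _).trans quadForm_basePoint

lemma continuous_blockMatrix : Continuous (blockMatrix : H A → _) := by
  have : Continuous fun h : H A => ((h : GL (Idx n) k) : Matrix (Idx n) (Idx n) k) :=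
    Units.continuous_val.comp continuous_subtype_val
  exact this.matrix_submatrix _ _

lemma continuous_orbitMap : Continuous (orbitMap A) := by
  refine Continuous.quotient_lift ?_ _
  have := continuous_blockMatrix (A := A)
  fun_prop

lemma isClosed_H : IsClosed (H A : Set (GL (Idx n) k)) := by
  have hv : Continuous fun g : GL (Idx n) k => (g : Matrix (Idx n) (Idx n) k) :=
    Units.continuous_val
  have h : (H A : Set (GL (Idx n) k)) =
      {g : GL (Idx n) k | (g : Matrix (Idx n) (Idx n) k) * gram A *
      (g : Matrix (Idx n) (Idx n) k)ᵀ = gram A} ∩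
      {g : GL (Idx n) k | eMinus k n ᵥ* (g : Matrix (Idx n) (Idx n) k) = eMinus k n} := rfl
  rw [h]
  exact (isClosed_eq (by fun_prop) continuous_const).inter
    (isClosed_eq (by fun_prop) continuous_const)

variable [ProperSpace k]

lemma locallyCompactSpace_H : LocallyCompactSpace (H A) := by
  have : LocallyCompactSpace (Matrix (Idx n) (Idx n) k) :=
    inferInstanceAs (LocallyCompactSpace (Idx n → Idx n → k))
  have : T1Space (Matrix (Idx n) (Idx n) k) :=
    inferInstanceAs (T1Space (Idx n → Idx n → k))
  exact isClosed_H.isClosedEmbedding_subtypeVal.locallyCompactSpace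

lemma secondCountableTopology_H : SecondCountableTopology (H A) := by
  have : SecondCountableTopology (Matrix (Idx n) (Idx n) k) :=
    inferInstanceAs (SecondCountableTopology (Idx n → Idx n → k))
  have : SecondCountableTopology (Matrix (Idx n) (Idx n) k)ᵐᵒᵖ :=
    MulOpposite.opHomeomorph.symm.isInducing.secondCountableTopology
  have : SecondCountableTopology (GL (Idx n) k) :=
    Units.isEmbedding_embedProduct.isInducing.secondCountableTopology
  exact Topology.IsInducing.subtypeVal.secondCountableTopology

lemma sigmaCompactSpace_thetaH : SigmaCompactSpace (ThetaH A) := by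
  have := locallyCompactSpace_H (A := A)
  have := secondCountableTopology_H (A := A)
  have hs : Function.Surjective (Quotient.mk _ : H A → ThetaH A) := Quotient.mk_surjective
  have hc : Continuous (Quotient.mk _ : H A → ThetaH A) := continuous_quotient_mk'
  have h := isSigmaCompact_range hc
  rw [hs.range_eq] at h
  exact isSigmaCompact_univ_iff.1 h

end Structure

/-- By injectivity the image of a compact set K has preimage exactly K, hence finite measure. The
complement of the range has empty preimage and is added to each piece to cover W. Thus the orbit map
need not be known to be proper. -/
lemma sigmaFinite_map_of_injective {X W : Type*} [TopologicalSpace X] [SigmaCompactSpace X]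
    [MeasurableSpace X] [BorelSpace X] [TopologicalSpace W] [T2Space W] [MeasurableSpace W]
    [BorelSpace W] {p : X → W} (hp : Continuous p) (hinj : Function.Injective p) (μ : Measure X)
    [IsFiniteMeasureOnCompacts μ] : SigmaFinite (μ.map p) := by
  have hK : ∀ i, MeasurableSet (p '' compactCovering X i) := fun i =>
    ((isCompact_compactCovering X i).image hp).measurableSet
  have hrange : Set.range p = ⋃ i, p '' compactCovering X i := by
    rw [← Set.image_iUnion, iUnion_compactCovering, Set.image_univ]
  have hR : MeasurableSet (Set.range p) := by
    rw [hrange]; exact MeasurableSet.iUnion hK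
  refine ⟨⟨{ set := fun i => p '' compactCovering X i ∪ (Set.range p)ᶜ
             set_mem := fun _ => trivial
             finite := fun i => ?_
             spanning := ?_ }⟩⟩
  · rw [Measure.map_apply hp.measurable ((hK i).union hR.compl)]
    have : p ⁻¹' (p '' compactCovering X i ∪ (Set.range p)ᶜ) = compactCovering X i := by
      rw [Set.preimage_union, Set.preimage_image_eq _ hinj]
      ext x; simp
    rw [this]
    exact (isCompact_compactCovering X i).measure_lt_top
  · rw [← Set.iUnion_union, ← hrange, Set.union_compl_self]

/-! ### The continuous square root on principal units. -/

section PrincipalSqrt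

variable {k : Type*} [NontriviallyNormedField k]

open Classical in
/-- The square root in the principal units of a principal unit (and `1` elsewhere). -/
noncomputable def principalSqrt (a : k) : k :=
  if h : ∃ t : k, ‖t - 1‖ < 1 ∧ t ^ 2 = a then h.choose else 1

lemma norm_principalSqrt_sub_one_lt (a : k) : ‖principalSqrt a - 1‖ < 1 := by
  rw [principalSqrt]
  split_ifs with h
  · exact h.choose_spec.1
  · simp

variable [IsUltrametricDist k]

lemma norm_principalSqrt (a : k) : ‖principalSqrt a‖ = 1 := by
  rw [← norm_one (α := k)]
  exact norm_eq_of_norm_sub_lt (by rw [norm_one]; exact norm_principalSqrt_sub_one_lt a)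

lemma principalSqrt_ne_zero (a : k) : principalSqrt a ≠ 0 :=
  norm_ne_zero_iff.1 (by rw [norm_principalSqrt]; exact one_ne_zero)

lemma principalSqrt_sq [ProperSpace k] (h2 : IsUnit (2 : IntRing k)) {a : k} (ha : ‖a - 1‖ < 1) :
    principalSqrt a ^ 2 = a := by
  have h := exists_sqrt_of_norm_sub_one_lt h2 ha
  rw [principalSqrt, dif_pos h]
  exact h.choose_spec.2

lemma principalSqrt_of_not {a : k} (ha : ¬ ‖a - 1‖ < 1) : principalSqrt a = 1 := by
  rw [principalSqrt, dif_neg]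
  rintro ⟨t, ht, rfl⟩
  apply ha
  have h1 : ‖t‖ = 1 := by
    rw [← norm_one (α := k)]
    exact norm_eq_of_norm_sub_lt (by rwa [norm_one])
  have h3 : ‖t + 1‖ ≤ 1 := (IsUltrametricDist.norm_add_le_max _ _).trans (by simp [h1])
  calc ‖t ^ 2 - 1‖ = ‖t - 1‖ * ‖t + 1‖ := by rw [← norm_mul]; ring_nf
    _ ≤ ‖t - 1‖ * 1 := by gcongr
    _ < 1 := by rwa [mul_one]

variable [ProperSpace k]

/-- For principal units a - b = (s - t)(s + t), where s + t ≡ 2 is a unit. Elsewhere the function is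
1, and points on different sides of this divide are at distance at least 1, so continuity holds on
all of k. -/
lemma norm_principalSqrt_sub_le (h2 : IsUnit (2 : IntRing k)) (a b : k) :
    ‖principalSqrt a - principalSqrt b‖ ≤ ‖a - b‖ := by
  have hlt : ∀ a b : k, ‖principalSqrt a - principalSqrt b‖ < 1 := by
    intro a b
    rw [show principalSqrt a - principalSqrt b =
      (principalSqrt a - 1) - (principalSqrt b - 1) by ring]
    exact (norm_sub_le_max _ _).trans_lt
      (max_lt (norm_principalSqrt_sub_one_lt a) (norm_principalSqrt_sub_one_lt b))
  by_cases hab : ‖a - b‖ < 1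
  · have hiff : ‖a - 1‖ < 1 ↔ ‖b - 1‖ < 1 := by
      constructor
      · intro h
        rw [show b - 1 = (a - 1) - (a - b) by ring]
        exact (norm_sub_le_max _ _).trans_lt (max_lt h hab)
      · intro h
        rw [show a - 1 = (a - b) + (b - 1) by ring]
        exact (IsUltrametricDist.norm_add_le_max _ _).trans_lt (max_lt hab h)
    by_cases ha : ‖a - 1‖ < 1
    · have hb := hiff.1 ha
      set s := principalSqrt a
      set t := principalSqrt b
      have hst : ‖s + t‖ = 1 := by
        rw [← norm_two h2]
        refine norm_eq_of_norm_sub_lt ?_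
        rw [norm_two h2, show s + t - 2 = (s - 1) + (t - 1) by ring]
        exact (IsUltrametricDist.norm_add_le_max _ _).trans_lt
          (max_lt (norm_principalSqrt_sub_one_lt a) (norm_principalSqrt_sub_one_lt b))
      have hsq : a - b = (s - t) * (s + t) := by
        rw [← principalSqrt_sq h2 ha, ← principalSqrt_sq h2 hb]; ring
      rw [hsq, norm_mul, hst, mul_one]
    · rw [principalSqrt_of_not ha, principalSqrt_of_not (fun h => ha (hiff.2 h)), sub_self,
        norm_zero]
      exact norm_nonneg _
  · exact (hlt a b).le.trans (not_lt.1 hab)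

lemma continuous_principalSqrt (h2 : IsUnit (2 : IntRing k)) :
    Continuous (principalSqrt : k → k) := by
  refine LipschitzWith.continuous (K := 1) (LipschitzWith.of_dist_le_mul fun a b => ?_)
  rw [dist_eq_norm, dist_eq_norm, NNReal.coe_one, one_mul]
  exact norm_principalSqrt_sub_le h2 a b

end PrincipalSqrt

/-! ### Radial projection and the cone measure. -/

section RadialProjection

variable {k : Type*} [NontriviallyNormedField k] [IsUltrametricDist k]
  {ι : Type*} [Fintype ι]

/-- The cone of vectors on which the quadratic form is a principal unit. -/
def principalCone (S : Matrix ι ι (IntRing k)) : Set (ι → k) :=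
  {v | ‖quadForm (integralMatrix S) v - 1‖ < 1}

/-- The radial projection of the cone to the vectors of length one. -/
noncomputable def radialProj (S : Matrix ι ι (IntRing k)) (v : ι → k) : ι → k :=
  (principalSqrt (quadForm (integralMatrix S) v))⁻¹ • v

lemma norm_radialProj (S : Matrix ι ι (IntRing k)) (v : ι → k) : ‖radialProj S v‖ = ‖v‖ := by
  rw [radialProj, norm_smul, norm_inv, norm_principalSqrt, inv_one, one_mul]

variable [ProperSpace k]

lemma quadForm_radialProj (h2 : IsUnit (2 : IntRing k)) {S : Matrix ι ι (IntRing k)} {v : ι → k}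
    (hv : v ∈ principalCone S) : quadForm (integralMatrix S) (radialProj S v) = 1 := by
  have h : quadForm (integralMatrix S) v ≠ 0 := by
    intro h0
    have : ‖quadForm (integralMatrix S) v - 1‖ < 1 := hv
    rw [h0] at this
    simp at this
  rw [radialProj, quadForm_smul, inv_pow, principalSqrt_sq h2 hv, inv_mul_cancel₀ h]

lemma continuous_radialProj (h2 : IsUnit (2 : IntRing k)) (S : Matrix ι ι (IntRing k)) :
    Continuous (radialProj S) := by
  have h1 := continuous_quadForm (integralMatrix S)
  have h3 := continuous_principalSqrt h2 (k := k)
  exact ((h3.comp h1).inv₀ fun v => principalSqrt_ne_zero _).smul continuous_id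

variable [MeasurableSpace k] [BorelSpace k]

lemma measurableSet_principalCone (S : Matrix ι ι (IntRing k)) :
    MeasurableSet (principalCone S) := by
  have := continuous_quadForm (integralMatrix S)
  exact (isOpen_lt (by fun_prop) continuous_const).measurableSet

/-- The cone measure on the vectors of length one. -/
noncomputable def coneMeasure (S : Matrix ι ι (IntRing k)) (m : Measure (ι → k)) :
    Measure (ι → k) :=
  (m.restrict (principalCone S)).map (radialProj S)

/-- Radial projection preserves the norm, so preimages of balls are balls. -/
lemma sigmaFinite_coneMeasure (h2 : IsUnit (2 : IntRing k)) (S : Matrix ι ι (IntRing k))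
    (m : Measure (ι → k)) [m.IsAddHaarMeasure] : SigmaFinite (coneMeasure S m) := by
  have hr := (continuous_radialProj h2 S).measurable
  refine ⟨⟨{ set := fun i => Metric.closedBall 0 i
             set_mem := fun _ => trivial
             finite := fun i => ?_
             spanning := Metric.iUnion_closedBall_nat 0 }⟩⟩
  have hb : MeasurableSet (Metric.closedBall (0 : ι → k) i) :=
    Metric.isClosed_closedBall.measurableSet
  rw [coneMeasure, Measure.map_apply hr hb]
  refine (Measure.restrict_apply_le _ _).trans_lt ?_
  have : radialProj S ⁻¹' Metric.closedBall 0 (i : ℝ) = Metric.closedBall 0 (i : ℝ) := by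
    ext v
    rw [Set.mem_preimage, mem_closedBall_zero_iff, mem_closedBall_zero_iff, norm_radialProj]
  rw [this]
  exact measure_closedBall_lt_top

lemma coneMeasure_ae (h2 : IsUnit (2 : IntRing k)) (S : Matrix ι ι (IntRing k))
    (m : Measure (ι → k)) :
    ∀ᵐ v ∂(coneMeasure S m), quadForm (integralMatrix S) v = 1 := by
  have hr := (continuous_radialProj h2 S).measurable
  have hq := continuous_quadForm (integralMatrix S)
  rw [coneMeasure, ae_map_iff hr.aemeasurable (isClosed_eq hq continuous_const).measurableSet]
  filter_upwards [ae_restrict_mem (measurableSet_principalCone S)] with v hv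
  exact quadForm_radialProj h2 hv

end RadialProjection

/-! ### Invariant measures on Θ\H versus the cone measure. -/

section Comparison

variable {k : Type*} [NontriviallyNormedField k] [IsUltrametricDist k] [ProperSpace k] {n : ℕ}
  [MeasurableSpace k] [BorelSpace k]
  {A : Matrix (Fin (n + 1)) (Fin (n + 1)) (IntRing k)}

lemma measurePreserving_vecMul_blockMatrix (hdet : IsUnit A.det) (m : Measure (SubIdx n → k))
    [m.IsAddHaarMeasure] (h : H A) :
    MeasurePreserving (fun v => v ᵥ* blockMatrix h) m m := by
  have hS : (integralMatrix (subGram A)).det ≠ 0 :=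
    det_integralMatrix_ne_zero (by rwa [det_subGram])
  have hb : (blockMatrix h).det ≠ 0 := by
    intro h0
    have := congrArg Matrix.det (blockMatrix_orthogonal h)
    rw [det_mul, det_mul, h0, zero_mul, zero_mul] at this
    exact hS this.symm
  exact measurePreserving_vecMul_of_orthogonal m hS
    (g := GeneralLinearGroup.mkOfDetNeZero _ hb) (blockMatrix_orthogonal h)

/-- H acts linearly and preserves the form, so it preserves Haar measure and the cone, and commutes
with the radial projection. -/
lemma measurePreserving_coneMeasure (h2 : IsUnit (2 : IntRing k)) (hdet : IsUnit A.det)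
    (m : Measure (SubIdx n → k)) [m.IsAddHaarMeasure] (h : H A) :
    MeasurePreserving (fun v => v ᵥ* blockMatrix h) (coneMeasure (subGram A) m)
      (coneMeasure (subGram A) m) := by
  have hr := (continuous_radialProj h2 (subGram A)).measurable
  have hm := measurePreserving_vecMul_blockMatrix hdet m h
  refine ⟨hm.measurable, ?_⟩
  have hcone : (fun v => v ᵥ* blockMatrix h) ⁻¹' principalCone (subGram A) =
      principalCone (subGram A) := by
    ext v
    simp only [principalCone, Set.mem_preimage, Set.mem_ofPred_eq, quadForm_vecMul_blockMatrix]
  have hres := hm.restrict_preimage (measurableSet_principalCone (subGram A))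
  rw [hcone] at hres
  have hcomm : (fun v => v ᵥ* blockMatrix h) ∘ radialProj (subGram A) =
      radialProj (subGram A) ∘ (fun v => v ᵥ* blockMatrix h) := by
    ext1 v
    simp only [Function.comp, radialProj, quadForm_vecMul_blockMatrix, smul_vecMul]
  rw [coneMeasure, Measure.map_map hm.measurable hr, hcomm, ← Measure.map_map hr hm.measurable,
    hres.map_eq]

/-- An invariant measure on `Θ \ H` is a multiple of the cone measure. -/
theorem exists_map_orbitMap_eq_smul (h2 : IsUnit (2 : IntRing k)) (hA : A.IsSymm)
    (hdet : IsUnit A.det) (m : Measure (SubIdx n → k)) [m.IsAddHaarMeasure]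
    (hm : coneMeasure (subGram A) m ≠ 0)
    (μ : Measure (ThetaH A)) [IsFiniteMeasureOnCompacts μ] (hμ0 : μ ≠ 0) (hμ : IsInvariant A μ) :
    ∃ c : NNReal, 0 < c ∧ μ.map (orbitMap A) = c • coneMeasure (subGram A) m := by
  have := locallyCompactSpace_H (A := A)
  have := secondCountableTopology_H (A := A)
  have := sigmaCompactSpace_thetaH (A := A)
  let _ : MeasurableSpace (H A) := borel (H A)
  have : BorelSpace (H A) := ⟨rfl⟩
  have hp := continuous_orbitMap (A := A)
  have := sigmaFinite_map_of_injective hp orbitMap_injective μ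
  have := sigmaFinite_coneMeasure h2 (subGram A) m
  have h20 : (2 : k) ≠ 0 := norm_ne_zero_iff.1 (by rw [norm_two h2]; exact one_ne_zero)
  have hcont : Continuous fun q : (SubIdx n → k) × H A => q.1 ᵥ* blockMatrix q.2 := by
    have := (continuous_blockMatrix (A := A)).comp
      (continuous_snd : Continuous fun q : (SubIdx n → k) × H A => q.2)
    exact Continuous.matrix_vecMul continuous_fst this
  have hq := continuous_quadForm (integralMatrix (subGram A))
  -- Haar measure of H serves only for the Fubini argument. Both measures are carried by the
  -- quadric, a single orbit.
  obtain ⟨c, hc, hμc⟩ := exists_eq_smul_of_invariant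
    (Measure.haar : Measure (H A)) (NeZero.ne _)
    (fun v h => v ᵥ* blockMatrix h) hcont.measurable vecMul_blockMatrix_one
    vecMul_blockMatrix_mul (μ := μ.map (orbitMap A)) hm
    (fun h => by
      have hmeas : Measurable fun v : SubIdx n → k => v ᵥ* blockMatrix h :=
        (by fun_prop : Continuous fun v : SubIdx n → k => v ᵥ* blockMatrix h).measurable
      refine ⟨hmeas, ?_⟩
      have hcomm : (fun v => v ᵥ* blockMatrix h) ∘ orbitMap A = orbitMap A ∘ translate A h :=
        funext fun z => (orbitMap_translate h z).symm
      rw [Measure.map_map hmeas hp.measurable, hcomm,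
        ← Measure.map_map hp.measurable (hμ h).measurable, (hμ h).map_eq])
    (measurePreserving_coneMeasure h2 hdet m) (basePoint k n)
    (by
      have : ∀ᵐ v ∂(μ.map (orbitMap A)), quadForm (integralMatrix (subGram A)) v = 1 := by
        rw [ae_map_iff hp.measurable.aemeasurable (isClosed_eq hq continuous_const).measurableSet]
        exact Filter.Eventually.of_forall quadForm_orbitMap
      filter_upwards [this] with v hv
      exact exists_basePoint_vecMul_eq h20 hA hv)
    (by
      filter_upwards [coneMeasure_ae h2 (subGram A) m] with v hv
      exact exists_basePoint_vecMul_eq h20 hA hv)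
  refine ⟨c.toNNReal, ?_, ?_⟩
  · refine ENNReal.toNNReal_pos ?_ hc
    rintro rfl
    rw [zero_smul, Measure.map_eq_zero_iff hp.measurable.aemeasurable] at hμc
    exact hμ0 hμc
  · rw [hμc, ← ENNReal.coe_toNNReal hc]
    rfl

end Comparison

/-! ### Integrals as series over shells. -/

section Series

lemma integrableOn_hasSum_of_eq_const {X : Type*} [MeasurableSpace X] {μ : Measure X}
    {E : ℕ → Set X} (hE : ∀ j, MeasurableSet (E j)) (hd : Pairwise (Function.onFun Disjoint E))
    (hfin : ∀ j, μ (E j) ≠ ⊤) {f : X → ℂ} {a : ℕ → ℂ} (hf : ∀ j, ∀ x ∈ E j, f x = a j)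
    (hs : Summable fun j => ‖a j‖ * μ.real (E j)) :
    IntegrableOn f (⋃ j, E j) μ ∧
      HasSum (fun j => a j * (μ.real (E j) : ℂ)) (∫ x in ⋃ j, E j, f x ∂μ) := by
  have hi : ∀ j, IntegrableOn f (E j) μ := fun j =>
    (integrableOn_congr_fun (hf j) (hE j)).2 (integrableOn_const (hfin j))
  have hint : IntegrableOn f (⋃ j, E j) μ := by
    refine integrableOn_iUnion_of_summable_integral_norm hi ?_
    refine hs.congr fun j => ?_
    rw [setIntegral_congr_fun (g := fun _ => ‖a j‖) (hE j) fun x hx => by simp only [hf j x hx]]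
    rw [setIntegral_const, smul_eq_mul, mul_comm]
  refine ⟨hint, ?_⟩
  have h := hasSum_integral_iUnion hE hd hint
  have he : (fun j => ∫ x in E j, f x ∂μ) = fun j => a j * (μ.real (E j) : ℂ) := funext fun j => by
    rw [setIntegral_congr_fun (hE j) (hf j), setIntegral_const, Complex.real_smul, mul_comm]
  rwa [he] at h

lemma ofReal_pow_cpow {r : ℝ} (hr : 0 ≤ r) (β : ℂ) (j : ℕ) :
    ((r ^ j : ℝ) : ℂ) ^ β = ((r : ℂ) ^ β) ^ j := by
  induction j with
  | zero => simp
  | succ j ih =>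
    rw [pow_succ, Complex.ofReal_mul, Complex.mul_cpow_ofReal_nonneg (by positivity) hr, ih, pow_succ]

lemma ofReal_inv_cpow {r : ℝ} (hr : 0 < r) (β : ℂ) :
    ((r⁻¹ : ℝ) : ℂ) ^ β = (r : ℂ) ^ (-β) := by
  have h : (r : ℂ) ^ β * ((r⁻¹ : ℝ) : ℂ) ^ β = 1 := by
    rw [← Complex.mul_cpow_ofReal_nonneg hr.le (by positivity), ← Complex.ofReal_mul,
      mul_inv_cancel₀ hr.ne']
    simp
  rw [Complex.cpow_neg]
  exact eq_inv_of_mul_eq_one_right h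

end Series

/-! ### The spherical function as a power of the norm. -/

section SphericalFunction

variable {k : Type*} [NontriviallyNormedField k] {n : ℕ}

lemma Phi_apply (w : Idx n → k) : Phi k n w = if ‖w‖ ≤ 1 then 1 else 0 := by
  classical
  rw [Phi, Set.indicator_apply]
  simp only [Set.mem_ofPred_eq, pi_norm_le_iff_of_nonneg zero_le_one, Pi.one_apply]

/-- Here eh = e₊h + e₋, with e₊h in k^(n+2): the last coordinate supplies the 1 in the maximum. -/
lemma norm_eIso_vecMul [IsUltrametricDist k]
    {A : Matrix (Fin (n + 1)) (Fin (n + 1)) (IntRing k)} (h : H A) :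
    ‖eIso k n ᵥ* ((h : GL (Idx n) k) : Matrix (Idx n) (Idx n) k)‖ =
      max 1 ‖basePoint k n ᵥ* blockMatrix h‖ := by
  have hm : eMinus k n ᵥ* ((h : GL (Idx n) k) : Matrix (Idx n) (Idx n) k) = eMinus k n := h.2.2
  rw [eIso, add_vecMul, hm, ← extend_basePoint, extend_vecMul]
  generalize basePoint k n ᵥ* blockMatrix h = x
  refine le_antisymm ?_ (max_le ?_ ?_)
  · refine (pi_norm_le_iff_of_nonneg (by positivity)).2 fun i => ?_
    rcases i with i | i | i
    · simpa [extend, eMinus] using Or.inr (norm_le_pi_norm x (Sum.inl i))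
    · simpa [extend, eMinus] using Or.inr (norm_le_pi_norm x (Sum.inr i))
    · simp [extend, eMinus]
  · refine le_trans ?_ (norm_le_pi_norm _ (Sum.inr (Sum.inr ())))
    simp [extend, eMinus]
  · refine (pi_norm_le_iff_of_nonneg (norm_nonneg _)).2 fun i => ?_
    refine le_trans (le_of_eq ?_) (norm_le_pi_norm _ (inclIdx n i))
    rcases i with i | i <;> simp [extend, eMinus, inclIdx]

variable [MeasurableSpace kˣ]

/-- The Tate integral of the characteristic function of the integers. -/
noncomputable def tateIntegral (ν : Measure kˣ) (α : ℂ) : ℂ :=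
  ∫ t : kˣ, ((‖(t : k)‖ : ℝ) : ℂ) ^ α * if ‖(t : k)‖ ≤ 1 then 1 else 0 ∂ν

/-- The integrand depends on g only through the norm of eg, and the substitution t ↦ ct scales this
norm away. No convergence is needed. -/
lemma phi_eq_cpow_mul_tateIntegral [BorelSpace kˣ] (ν : Measure kˣ) [ν.IsHaarMeasure] (α : ℂ)
    (g : GL (Idx n) k) (c : kˣ)
    (hc : ‖eIso k n ᵥ* (g : Matrix (Idx n) (Idx n) k)‖ = ‖(c : k)‖) :
    phi ν α g = ((‖(c : k)‖ : ℝ) : ℂ) ^ (-α) * tateIntegral ν α := by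
  rw [tateIntegral, ← integral_mul_left_eq_self _ c, ← integral_const_mul, phi]
  congr 1
  ext t
  have hc0 : (0 : ℝ) < ‖(c : k)‖ := norm_pos_iff.2 c.ne_zero
  rw [Phi_apply, norm_smul, hc, Units.val_mul, norm_mul, mul_comm ‖(c : k)‖, Complex.ofReal_mul,
    Complex.mul_cpow_ofReal_nonneg (norm_nonneg _) hc0.le, ← mul_assoc, mul_comm (_ ^ (-α)),
    mul_assoc (((‖(t : k)‖ : ℝ) : ℂ) ^ α), ← Complex.cpow_add _ _ (by exact_mod_cast hc0.ne')]
  simp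

variable [IsUltrametricDist k] [ProperSpace k]

/-- The shells ‖t‖ = q^(-j) are translates of the unit group, each of volume 1, so the integral is a
geometric series in q^(-α). -/
lemma tateIntegral_eq_Zfactor [BorelSpace kˣ] (hk : IsNormalized k) (ν : Measure kˣ)
    [ν.IsHaarMeasure] (hν : ν {t : kˣ | ‖(t : k)‖ = 1} = 1) {α : ℂ} (hα : 0 < α.re) :
    tateIntegral ν α = Zfactor k α ∧ Zfactor k α ≠ 0 := by
  have hq : (1 : ℝ) < resCard k := by exact_mod_cast one_lt_resCard k
  have hq0 : (0 : ℝ) < resCard k := by positivity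
  obtain ⟨ϖ, hϖ, hval⟩ := exists_uniformizer hk
  have hϖ0 : ϖ ≠ 0 := norm_ne_zero_iff.1 (by rw [hϖ]; positivity)
  let u : kˣ := Units.mk0 ϖ hϖ0
  have hu : ‖(u : k)‖ = (resCard k : ℝ)⁻¹ := hϖ
  let E : ℕ → Set kˣ := fun j => {t | ‖(t : k)‖ = ((resCard k : ℝ)⁻¹) ^ j}
  have hcont : Continuous fun t : kˣ => ‖(t : k)‖ := continuous_norm.comp Units.continuous_val
  have hE : ∀ j, MeasurableSet (E j) := fun j =>
    (isClosed_eq hcont continuous_const).measurableSet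
  have hν1 : ∀ j, ν (E j) = 1 := by
    intro j
    rw [← hν, ← measure_preimage_mul ν (u ^ j) (E j)]
    congr 1
    ext t
    simp only [E, Set.mem_preimage, Set.mem_ofPred_eq, Units.val_mul, Units.val_pow_eq_pow_val,
      norm_mul, norm_pow, hu]
    exact mul_eq_left₀ (by positivity)
  have hd : Pairwise (Function.onFun Disjoint E) := by
    intro i j hij
    refine Set.disjoint_left.2 fun t hi hj => hij ?_
    have h := (Set.mem_ofPred_eq ▸ hi : ‖(t : k)‖ = _).symm.trans hj
    exact pow_right_injective₀ (by positivity) (inv_lt_one_of_one_lt₀ hq).ne h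
  have hunion : ⋃ j, E j = {t : kˣ | ‖(t : k)‖ ≤ 1} := by
    ext t
    simp only [E, Set.mem_iUnion, Set.mem_ofPred_eq]
    constructor
    · rintro ⟨j, hj⟩
      rw [hj]
      exact pow_le_one₀ (by positivity) (inv_le_one_of_one_le₀ hq.le)
    · intro ht
      obtain ⟨m, hm⟩ := hval t t.ne_zero
      have hm0 : m ≤ 0 := by
        by_contra! h
        rw [hm] at ht
        exact absurd ht (not_le.2 (one_lt_zpow₀ hq h))
      refine ⟨(-m).toNat, ?_⟩
      rw [hm, inv_pow, ← zpow_natCast, Int.toNat_of_nonneg (by omega), _root_.zpow_neg, inv_inv]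
  set x : ℂ := (resCard k : ℂ) ^ (-α) with hx
  have hxn : ‖x‖ < 1 := by
    rw [hx, ← Complex.ofReal_natCast, Complex.norm_cpow_eq_rpow_re_of_pos hq0]
    exact Real.rpow_lt_one_of_one_lt_of_neg hq (by simpa using hα)
  have hreal : ∀ j, ν.real (E j) = 1 := fun j => by rw [Measure.real, hν1, ENNReal.toReal_one]
  obtain ⟨-, hsum⟩ := integrableOn_hasSum_of_eq_const (μ := ν) hE hd
    (fun j => by rw [hν1]; exact ENNReal.one_ne_top)
    (f := fun t => ((‖(t : k)‖ : ℝ) : ℂ) ^ α * if ‖(t : k)‖ ≤ 1 then 1 else 0) (a := fun j => x ^ j)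
    (fun j t ht => by
      have ht1 : ‖(t : k)‖ ≤ 1 := by
        have : t ∈ ⋃ j, E j := Set.mem_iUnion_of_mem j ht
        rw [hunion] at this
        exact this
      have ht' : ‖(t : k)‖ = ((resCard k : ℝ)⁻¹) ^ j := ht
      rw [if_pos ht1, mul_one, ht', ofReal_pow_cpow (by positivity), ofReal_inv_cpow hq0]
      simp [hx])
    (by
      simp only [hreal, mul_one, norm_pow]
      exact summable_geometric_of_lt_one (norm_nonneg _) hxn)
  simp only [hreal, Complex.ofReal_one, mul_one] at hsum
  have h1 := hsum.unique (hasSum_geometric_of_norm_lt_one hxn)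
  have h1x : 1 - x ≠ 0 := by
    intro h
    rw [sub_eq_zero] at h
    rw [← h] at hxn
    simp at hxn
  refine ⟨?_, ?_⟩
  · rw [Zfactor, one_div, ← h1, tateIntegral]
    rw [setIntegral_eq_integral_of_forall_compl_eq_zero]
    intro t ht
    rw [hunion] at ht
    have ht' : ¬ ‖(t : k)‖ ≤ 1 := ht
    rw [if_neg ht', mul_zero]
  · rw [Zfactor]
    exact one_div_ne_zero h1x

/-- The spherical function on `Θ \ H` in terms of the orbit map. -/
theorem phiQuot_eq [BorelSpace kˣ] (hk : IsNormalized k) (ν : Measure kˣ)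
    [ν.IsHaarMeasure] (hν : ν {t : kˣ | ‖(t : k)‖ = 1} = 1) {α : ℂ} (hα : 0 < α.re)
    (A : Matrix (Fin (n + 1)) (Fin (n + 1)) (IntRing k)) (z : ThetaH A) :
    phiQuot ν α A z = ((max 1 ‖orbitMap A z‖ : ℝ) : ℂ) ^ (-α) := by
  obtain ⟨hJ, hZ⟩ := tateIntegral_eq_Zfactor hk ν hν hα
  have hphi : ∀ h : H A, phi ν α (h : GL (Idx n) k) =
      ((max 1 ‖basePoint k n ᵥ* blockMatrix h‖ : ℝ) : ℂ) ^ (-α) * tateIntegral ν α := by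
    intro h
    obtain ⟨c, hc⟩ : ∃ c : kˣ, ‖(c : k)‖ = max 1 ‖basePoint k n ᵥ* blockMatrix h‖ := by
      rcases max_choice 1 ‖basePoint k n ᵥ* blockMatrix h‖ with h1 | h1
      · exact ⟨1, by rw [h1]; simp⟩
      · obtain ⟨i, hi⟩ : ∃ i, ‖(basePoint k n ᵥ* blockMatrix h) i‖ =
            ‖basePoint k n ᵥ* blockMatrix h‖ := by
          obtain ⟨i, hi⟩ := Finite.exists_max fun i => ‖(basePoint k n ᵥ* blockMatrix h) i‖
          exact ⟨i, le_antisymm (norm_le_pi_norm _ i)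
            ((pi_norm_le_iff_of_nonneg (norm_nonneg _)).2 hi)⟩
        have h3 : (basePoint k n ᵥ* blockMatrix h) i ≠ 0 := by
          rw [← norm_ne_zero_iff, hi, ← h1]
          positivity
        exact ⟨Units.mk0 _ h3, by rw [h1, ← hi]; rfl⟩
    rw [← hc]
    exact phi_eq_cpow_mul_tateIntegral ν α _ c (by rw [norm_eIso_vecMul, hc])
  have h1 : phi ν α (1 : GL (Idx n) k) = tateIntegral ν α := by
    rw [phi_eq_cpow_mul_tateIntegral ν α 1 1 (by
      have := norm_eIso_vecMul (1 : H A)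
      rw [vecMul_blockMatrix_one] at this
      refine Eq.trans this ?_
      simp [basePoint, Pi.norm_single])]
    simp
  obtain ⟨h⟩ := z
  change phi ν α (h : GL (Idx n) k) / phi ν α 1 = _
  rw [hphi, h1, mul_div_assoc, div_self (by rw [hJ]; exact hZ), mul_one]
  rfl

end SphericalFunction

/-! ### The integral over the cone. -/

section ConeIntegral

variable {k : Type*} [NontriviallyNormedField k] [IsUltrametricDist k]
  {ι : Type*} [Fintype ι]

lemma quadChar_eq_one_or_neg_one (u : IntRing k) : quadChar u = 1 ∨ quadChar u = -1 := by
  rw [quadChar]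
  split_ifs
  · exact Or.inl rfl
  · exact Or.inr rfl

/-- An integral form satisfies |Q(v)| ≤ ‖v‖², and |Q(v)| = 1 on the cone. Hence only shells with j ≥
0 occur. -/
lemma one_le_norm_of_mem_principalCone {S : Matrix ι ι (IntRing k)} {v : ι → k}
    (hv : v ∈ principalCone S) : 1 ≤ ‖v‖ := by
  by_contra! h
  have hQ : ‖quadForm (integralMatrix S) v‖ = 1 := by
    rw [← norm_one (α := k)]
    exact norm_eq_of_norm_sub_lt (by rw [norm_one]; exact hv)
  have hle : ‖quadForm (integralMatrix S) v‖ ≤ ‖v‖ * ‖v‖ := by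
    refine IsUltrametricDist.norm_sum_le_of_forall_le_of_nonneg (by positivity) fun i _ => ?_
    rw [norm_mul]
    exact mul_le_mul (norm_le_pi_norm v i) (norm_integralMatrix_mulVec_le S v i) (norm_nonneg _)
      (norm_nonneg _)
  nlinarith [norm_nonneg v]

variable [ProperSpace k]

lemma pairwise_disjoint_levelSet (S : Matrix ι ι (IntRing k)) :
    Pairwise (Function.onFun Disjoint (levelSet S)) := by
  have hq : (1 : ℝ) < resCard k := by exact_mod_cast one_lt_resCard k
  intro i j hij
  refine Set.disjoint_left.2 fun v hi hj => hij ?_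
  exact pow_right_injective₀ (by positivity) hq.ne' (hi.1.symm.trans hj.1)

lemma principalCone_eq_iUnion_levelSet (hk : IsNormalized k) (S : Matrix ι ι (IntRing k)) :
    principalCone S = ⋃ j, levelSet S j := by
  have hq : (1 : ℝ) < resCard k := by exact_mod_cast one_lt_resCard k
  obtain ⟨-, -, hval⟩ := exists_uniformizer hk
  ext v
  simp only [Set.mem_iUnion]
  constructor
  · intro hv
    have h1 := one_le_norm_of_mem_principalCone hv
    have hne : Nonempty ι := by
      by_contra hne
      rw [not_nonempty_iff] at hne
      rw [Subsingleton.elim v 0, norm_zero] at h1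
      linarith
    obtain ⟨i, hi⟩ := Finite.exists_max fun i => ‖v i‖
    have hvi : ‖v‖ = ‖v i‖ := le_antisymm ((pi_norm_le_iff_of_nonneg (norm_nonneg _)).2 hi)
      (norm_le_pi_norm v i)
    rw [hvi] at h1
    obtain ⟨m, hm⟩ := hval (v i) (norm_ne_zero_iff.1 (by linarith))
    have hm0 : 0 ≤ m := by
      by_contra! h
      rw [hm] at h1
      exact absurd h1 (not_le.2 (zpow_lt_one_of_neg₀ hq h))
    refine ⟨m.toNat, ?_, hv⟩
    rw [hvi, hm, ← zpow_natCast, Int.toNat_of_nonneg hm0]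
  · rintro ⟨j, hj⟩
    exact hj.2

variable [MeasurableSpace k] [BorelSpace k]

lemma measure_levelSet_ne_top (S : Matrix ι ι (IntRing k)) (m : Measure (ι → k))
    [m.IsAddHaarMeasure] (j : ℕ) : m (levelSet S j) ≠ ⊤ := by
  refine ((measure_mono fun v hv => ?_).trans_lt
    (measure_closedBall_lt_top (μ := m) (x := 0) (r := (resCard k : ℝ) ^ j))).ne
  exact mem_closedBall_zero_iff.2 hv.1.le

variable [DecidableEq ι]

/-- Since r > 0, q^(2r) exceeds q^r whatever the sign. This makes the cone measure nonzero and the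
final constant positive. -/
lemma measureReal_levelSet_zero_pos (hk : IsNormalized k) (h2 : IsUnit (2 : IntRing k))
    {S : Matrix ι ι (IntRing k)} (hS : S.IsSymm) (hdet : IsUnit S.det) {r : ℕ} (hr : 0 < r)
    (hι : Fintype.card ι = 2 * r + 1) (m : Measure (ι → k)) [m.IsAddHaarMeasure] :
    0 < m.real (levelSet S 0) := by
  have hq : (1 : ℝ) < resCard k := by exact_mod_cast one_lt_resCard k
  have hb : 0 < m.real (Metric.ball (0 : ι → k) 1) :=
    ENNReal.toReal_pos (measure_ball_one_pos m).ne' (measure_ball_one_ne_top m)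
  have h := (measureReal_levelSet m hk h2 hS hdet hι).1
  have hpow : (resCard k : ℝ) ^ r < (resCard k : ℝ) ^ (2 * r) := pow_lt_pow_right₀ hq (by omega)
  have hpos : (0 : ℝ) < (resCard k : ℝ) ^ r := by positivity
  rcases quadChar_eq_one_or_neg_one ((-1) ^ r * S.det) with hε | hε
  · rw [hε] at h
    have h' : m.real (levelSet S 0) = ((resCard k : ℝ) ^ (2 * r) + 1 * (resCard k : ℝ) ^ r) *
        m.real (Metric.ball 0 1) := by exact_mod_cast h
    rw [h']
    positivity
  · rw [hε] at h
    have h' : m.real (levelSet S 0) = ((resCard k : ℝ) ^ (2 * r) + (-1) * (resCard k : ℝ) ^ r) *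
        m.real (Metric.ball 0 1) := by exact_mod_cast h
    rw [h']
    exact mul_pos (by linarith) hb

/-- The integral of a power of the norm over the cone. -/
theorem integral_principalCone (hk : IsNormalized k) (h2 : IsUnit (2 : IntRing k))
    {S : Matrix ι ι (IntRing k)} (hS : S.IsSymm) (hdet : IsUnit S.det) {r : ℕ} (hr : 0 < r)
    (hι : Fintype.card ι = 2 * r + 1) (m : Measure (ι → k)) [m.IsAddHaarMeasure] {α : ℂ}
    (hα : 2 * (r : ℝ) - 1 < α.re) :
    IntegrableOn (fun v => ((max 1 ‖v‖ : ℝ) : ℂ) ^ (-α)) (principalCone S) m ∧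
    ∫ v in principalCone S, ((max 1 ‖v‖ : ℝ) : ℂ) ^ (-α) ∂m =
      (m.real (levelSet S 0) : ℂ) * (Zfactor k (α - (2 * r - 1)) /
        Lfactor ((-1) ^ r * S.det) (α - r + 1)) := by
  have hq : (1 : ℝ) < resCard k := by exact_mod_cast one_lt_resCard k
  have hq0 : (0 : ℝ) < resCard k := by positivity
  have hqc : (resCard k : ℂ) ≠ 0 := by exact_mod_cast hq0.ne'
  obtain ⟨hV0, hV⟩ := measureReal_levelSet m hk h2 hS hdet hι
  set q : ℂ := (resCard k : ℂ) with hqdef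
  set ε := quadChar ((-1) ^ r * S.det) with hε
  set b : ℂ := (m.real (Metric.ball (0 : ι → k) 1) : ℂ) with hb
  set x : ℂ := q ^ (-α) with hx
  -- The ratio of the series over the shells; the bound on Re α says exactly that ‖y‖ < 1.
  set y : ℂ := q ^ (-(α - (2 * r - 1))) with hy
  set z : ℂ := q ^ (-(α - r + 1)) with hz
  have hyx : y = x * q ^ (2 * r - 1) := by
    have : -(α - (2 * r - 1)) = -α + ((2 * r - 1 : ℕ) : ℂ) := by
      rw [Nat.cast_sub (by omega)]; push_cast; ring
    rw [hy, this, Complex.cpow_add _ _ hqc, Complex.cpow_natCast]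
  have hyz : y = z * q ^ r := by
    have : -(α - (2 * r - 1)) = -(α - r + 1) + (r : ℂ) := by ring
    rw [hy, this, Complex.cpow_add _ _ hqc, Complex.cpow_natCast]
  have hyn : ‖y‖ < 1 := by
    rw [hy, hqdef, ← Complex.ofReal_natCast, Complex.norm_cpow_eq_rpow_re_of_pos hq0]
    refine Real.rpow_lt_one_of_one_lt_of_neg hq ?_
    simp
    linarith
  have h1y : 1 - y ≠ 0 := by
    intro h
    rw [sub_eq_zero] at h
    rw [← h] at hyn
    simp at hyn
  have hterm : ∀ j, x ^ (j + 1) * (m.real (levelSet S (j + 1)) : ℂ) =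
      (q ^ (2 * r) - 1) * b * y * y ^ j := by
    intro j
    have h3 : q ^ (2 * (j + 1)) ≠ 0 := pow_ne_zero _ hqc
    apply mul_right_cancel₀ h3
    rw [mul_assoc, hV j, hι, hyx]
    have h4 : q ^ ((j + 1) * (2 * r + 1)) = (q ^ (2 * r - 1)) ^ (j + 1) * q ^ (2 * (j + 1)) := by
      rw [← pow_mul, ← pow_add]
      congr 1
      obtain ⟨l, rfl⟩ : ∃ l, r = l + 1 := ⟨r - 1, by omega⟩
      rw [show 2 * (l + 1) - 1 = 2 * l + 1 by omega]
      ring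
    rw [h4]
    ring
  have hF : ∀ j, ∀ v ∈ levelSet S j, ((max 1 ‖v‖ : ℝ) : ℂ) ^ (-α) = x ^ j := by
    intro j v hv
    have hv1 : ‖v‖ = (resCard k : ℝ) ^ j := hv.1
    rw [hv1, max_eq_right (one_le_pow₀ hq.le), ofReal_pow_cpow hq0.le, Complex.ofReal_natCast]
  have hsummable : Summable fun j => ‖x ^ j‖ * m.real (levelSet S j) := by
    rw [← summable_nat_add_iff 1]
    have : ∀ j, ‖x ^ (j + 1)‖ * m.real (levelSet S (j + 1)) =
        ‖(q ^ (2 * r) - 1) * b * y‖ * ‖y‖ ^ j := by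
      intro j
      rw [← norm_pow, ← norm_mul, ← hterm j, norm_mul, Complex.norm_real, Real.norm_eq_abs,
        abs_of_nonneg measureReal_nonneg]
    simp only [this]
    exact (summable_geometric_of_lt_one (norm_nonneg _) hyn).mul_left _
  obtain ⟨hint, hsum⟩ := integrableOn_hasSum_of_eq_const (measurableSet_levelSet S)
    (pairwise_disjoint_levelSet S) (measure_levelSet_ne_top S m) hF hsummable
  rw [← principalCone_eq_iUnion_levelSet hk] at hint hsum
  refine ⟨hint, ?_⟩
  have htail : HasSum (fun j => x ^ (j + 1) * (m.real (levelSet S (j + 1)) : ℂ))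
      ((q ^ (2 * r) - 1) * b * y * (1 - y)⁻¹) := by
    simp only [hterm]
    exact (hasSum_geometric_of_norm_lt_one hyn).mul_left _
  have htot := (hasSum_nat_add_iff (f := fun j => x ^ j * (m.real (levelSet S j) : ℂ)) 1).1 htail
  rw [hsum.unique htot]
  have hε2 : ε * ε = 1 := by
    rcases quadChar_eq_one_or_neg_one ((-1) ^ r * S.det) with h | h
    · rw [hε, h]; ring
    · rw [hε, h]; ring
  -- What remains is q^(2r) + εq^r + (q^(2r) - 1)y/(1 - y) = (q^(2r) + εq^r)(1 - εz)/(1 - y), where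
  -- y = zq^r and ε² = 1.
  rw [Zfactor, Lfactor, ← hqdef, ← hy, ← hz, ← hε, Finset.sum_range_one, pow_zero, one_mul, hV0,
    div_div_eq_mul_div, div_one, one_div]
  field_simp
  rw [hyz]
  linear_combination (b * z * q ^ r) * hε2

end ConeIntegral

end OrthogonalPeriod

/-! ### The period integral. -/

theorem propositionp {k : Type*} [NontriviallyNormedField k] [IsUltrametricDist k]
    [LocallyCompactSpace k] (hk : OrthogonalPeriod.IsNormalized k)
    (h2 : IsUnit (2 : OrthogonalPeriod.IntRing k)) {n : ℕ} (hn : Odd n)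
    (A : Matrix (Fin (n + 1)) (Fin (n + 1)) (OrthogonalPeriod.IntRing k)) (hA : A.IsSymm) (hdet : IsUnit A.det)
    [MeasurableSpace kˣ] [BorelSpace kˣ] (ν : Measure kˣ) [ν.IsHaarMeasure]
    (hν : ν {t : kˣ | ‖(t : k)‖ = 1} = 1)
    (μ : Measure (OrthogonalPeriod.ThetaH A)) [IsFiniteMeasureOnCompacts μ] (hμ0 : μ ≠ 0)
    (hμ : OrthogonalPeriod.IsInvariant A μ) :
    ∃ C : ℝ, 0 < C ∧ ∀ s : ℂ, 0 < (((n : ℂ) + 1) * (s - 1) + 1).re →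
      Integrable (OrthogonalPeriod.phiQuot ν (((n : ℂ) + 1) * s) A) μ ∧
      ∫ x, OrthogonalPeriod.phiQuot ν (((n : ℂ) + 1) * s) A x ∂μ =
        (C : ℂ) * (OrthogonalPeriod.Zfactor k (((n : ℂ) + 1) * (s - 1) + 1) /
          OrthogonalPeriod.Lfactor (OrthogonalPeriod.disc A)
            (((n : ℂ) + 1) * (s - 1 / 2) + 1)) := by
  open OrthogonalPeriod in
  have := properSpace_of_locallyCompact (k := k)
  let _ : MeasurableSpace k := borel k
  have : BorelSpace k := ⟨rfl⟩
  obtain ⟨l, hl⟩ := hn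
  set r : ℕ := (n + 1) / 2 with hr
  have hnr : n + 1 = 2 * r := by omega
  have hr0 : 0 < r := by omega
  have hι : Fintype.card (SubIdx n) = 2 * r + 1 := by simp; omega
  have hS := isSymm_subGram hA
  have hSdet : IsUnit (subGram A).det := by rwa [det_subGram]
  let m : Measure (SubIdx n → k) := Measure.addHaar
  have hV := measureReal_levelSet_zero_pos hk h2 hS hSdet hr0 hι m
  have hrad := (continuous_radialProj h2 (subGram A)).measurable
  have hcone : coneMeasure (subGram A) m ≠ 0 := by
    rw [coneMeasure, Ne, Measure.map_eq_zero_iff hrad.aemeasurable, Measure.restrict_eq_zero]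
    intro h0
    have : m (levelSet (subGram A) 0) = 0 := measure_mono_null (fun v hv => hv.2) h0
    rw [Measure.real, this] at hV
    simp at hV
  obtain ⟨c, hc, hμc⟩ := exists_map_orbitMap_eq_smul h2 hA hdet m hcone μ hμ0 hμ
  -- The constant combines the ratio of μ to the cone measure with the volume of the shell j = 0;
  -- neither involves s.
  refine ⟨c * m.real (levelSet (subGram A) 0), by positivity, fun s hs => ?_⟩
  set α : ℂ := ((n : ℂ) + 1) * s with hα
  have hnrc : (n : ℂ) + 1 = 2 * (r : ℂ) := by exact_mod_cast hnr
  have hβ : ((n : ℂ) + 1) * (s - 1) + 1 = α - (2 * r - 1) := by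
    rw [hα]; linear_combination -hnrc
  have hγ : ((n : ℂ) + 1) * (s - 1 / 2) + 1 = α - r + 1 := by
    rw [hα]; linear_combination (-1 / 2) * hnrc
  have hαre : 2 * (r : ℝ) - 1 < α.re := by
    rw [hβ] at hs
    simp at hs
    linarith
  -- As r ≥ 1, the half-plane of the theorem lies inside the domain of convergence of the integral
  -- defining φ.
  have hα0 : 0 < α.re := by
    have : (1 : ℝ) ≤ r := by exact_mod_cast hr0
    linarith
  obtain ⟨hint, hval⟩ := integral_principalCone hk h2 hS hSdet hr0 hι m hαre
  set F : (SubIdx n → k) → ℂ := fun v => ((max 1 ‖v‖ : ℝ) : ℂ) ^ (-α) with hF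
  have hphi : phiQuot ν α A = F ∘ orbitMap A := funext fun z => phiQuot_eq hk ν hν hα0 A z
  have hFm : Measurable F := by
    have : Measurable fun v : SubIdx n → k => ((max 1 ‖v‖ : ℝ) : ℂ) := by fun_prop
    exact this.pow_const _
  have hFr : F ∘ radialProj (subGram A) = F := by
    ext v
    simp only [hF, Function.comp, norm_radialProj]
  have hpm := (continuous_orbitMap (A := A)).measurable
  constructor
  · rw [hphi, ← integrable_map_measure hFm.aestronglyMeasurable hpm.aemeasurable, hμc]
    refine Integrable.smul_measure_nnreal ?_
    rw [coneMeasure, integrable_map_measure hFm.aestronglyMeasurable hrad.aemeasurable, hFr]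
    exact hint
  · have h1 : ∫ z, phiQuot ν α A z ∂μ = ∫ v, F v ∂(μ.map (orbitMap A)) := by
      rw [hphi, integral_map hpm.aemeasurable hFm.aestronglyMeasurable]
      rfl
    have h3 : ∫ v, F v ∂(coneMeasure (subGram A) m) = ∫ v in principalCone (subGram A), F v ∂m := by
      rw [coneMeasure, integral_map hrad.aemeasurable hFm.aestronglyMeasurable]
      exact congrArg (fun f => ∫ v in principalCone (subGram A), f v ∂m) hFr
    rw [h1, hμc, integral_smul_nnreal_measure, h3, hval, hβ, hγ, det_subGram, NNReal.smul_def,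
      Complex.real_smul]
    -- The exponent (n+1)/2 in the discriminant is the r of the point count, so the two signs agree.
    rw [disc, ← hr]
    push_cast
    ring
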